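/- \textbf{Theorem.} Let a finite set $P\subset\mathbb{R}^2$ be in \emph{general orthogonal position} if no two distinct points of $P$ share an $x$-coordinate or a $y$-coordinate. A \emph{planar L-shaped drawing} of a graph $G$ on $P$ places the vertices of $G$ at distinct points of $P$ (not all points of $P$ need be used, and any vertex may be placed at any point) and draws every edge $uv$ as an orthogonal path consisting of one horizontal and one vertical segment (so with a single bend) joining the points of $u$ and $v$, such that no edge passes through a vertex other than its own endpoints and two different edges meet at most in a common endpoint. There is an absolute constant $c>0$ such that for every $n\ge 1$, every tree $T$ on $n$ vertices with maximum degree at most $3$, and every finite set $P\subset\mathbb{R}^2$ in general orthogonal position with $|P|\ge c\,n^{1.22}$, the tree $T$ has a planar L-shaped drawing on $P$. -/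

import Mathlib

/-- A set of points in the plane is in general orthogonal position if no two distinct points of it
share the same `x`-coordinate or the same `y`-coordinate. -/
def GeneralOrthogonalPosition (P : Finset (ℝ × ℝ)) : Prop :=
  ∀ p ∈ P, ∀ q ∈ P, p ≠ q → p.1 ≠ q.1 ∧ p.2 ≠ q.2

/-- The orthogonal path of two segments that leaves `p` horizontally, bends once at `(q.1, p.2)`,
and arrives at `q` vertically. The other L-shaped path between the same two points is
`LPath q p`. -/
def LPath (p q : ℝ × ℝ) : Set (ℝ × ℝ) :=
  segment ℝ p (q.1, p.2) ∪ segment ℝ (q.1, p.2) q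

/-- `pos` and `curve` form a planar L-shaped drawing of the graph `G` on the point set `P`:
`pos` is the placement of the vertices and `curve e` is the set of points of the plane covered by
the edge `e`. -/
structure IsPlanarLDrawing {V : Type*} (G : SimpleGraph V) (P : Finset (ℝ × ℝ))
    (pos : V → ℝ × ℝ) (curve : Sym2 V → Set (ℝ × ℝ)) : Prop where
  /-- The vertices are placed at points of `P`. -/
  pos_mem : ∀ v, pos v ∈ P
  /-- Different vertices are placed at different points. -/
  pos_injective : Function.Injective pos
  /-- Every edge is drawn as one of the two L-shaped paths between its endpoints. -/
  curve_eq : ∀ u v, G.Adj u v →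
    curve s(u, v) = LPath (pos u) (pos v) ∨ curve s(u, v) = LPath (pos v) (pos u)
  /-- An edge passes through no vertex other than its own endpoints. -/
  pos_mem_curve : ∀ e ∈ G.edgeSet, ∀ w, pos w ∈ curve e → w ∈ e
  /-- Two different edges meet at most at a common endpoint. -/
  curve_inter : ∀ e ∈ G.edgeSet, ∀ e' ∈ G.edgeSet, e ≠ e' →
    ∀ z, z ∈ curve e → z ∈ curve e' → ∃ w, w ∈ e ∧ w ∈ e' ∧ pos w = z

/-- The graph `G` has a planar L-shaped drawing on the point set `P`. (Not all the points of `P`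
have to be used, and any vertex may be placed at any point.) -/
def HasPlanarLDrawing {V : Type*} (G : SimpleGraph V) (P : Finset (ℝ × ℝ)) : Prop :=
  ∃ (pos : V → ℝ × ℝ) (curve : Sym2 V → Set (ℝ × ℝ)), IsPlanarLDrawing G P pos curve

/-!
A tree of maximum degree at most three is a binary tree hanging from one of its leaves, so it
suffices to draw binary trees. The statement proved by induction on the number `n` of nodes
(`DrawingCost.topDrawable`) is that `f n = ⌈10 ^ 30 * n ^ 1.22⌉` points in general orthogonal
position carry a drawing that stays in their bounding box and whose root is a highest point of the
drawing. By transposing the plane, a smaller tree can then also be drawn with its root as a leftmost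
or rightmost point. Hence a subtree can be hung from a point `v` into a set of points below `v` on
one side of it (a pocket), by an edge that leaves `v` either horizontally or vertically
(`TopDrawable.exists_branch_down`, `TopDrawable.exists_branch_side`).

Let the subtrees at the root have `p ≤ q` nodes. If `p` is tiny compared with `n`, the topmost point
becomes the root, the lighter subtree goes to an extreme left or right strip, and the heavier one is
drawn in between (`TopDrawable.drawn_light`); this needs `2 * f p + f q + 1 ≤ f n`. Otherwise the
top points are cut into many groups of points consecutive in `x`-direction. Below one of these
groups there are so few points that nearly all points lie in the two pockets to the left and to the
right of it (`exists_pockets`), and `10 * f q + 13 * f p` is smaller than `10 * f n` by a definite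
factor, so the pockets have room for `f q + 1.3 * f p` points.

The points of the group carry a spine, which runs downwards. At a vertex of the spine either both
subtrees fit into the pockets, and the drawing is complete, or one subtree is put into the outer
strip of a pocket and the spine continues with the other one at the next point. The choice of the
pocket is forced by the side on which the next point lies, because the edge to it must not meet the
edge to the strip.

* If the pockets have room for `1.3 * f n` points, this never gets stuck (`Pockets.topSafe`).
* In general the spine starts in a set `X`. When one pocket is about to become too small for the
  next lighter subtree, the spine moves to a set `H` below `X` and to its side
  (`Pockets.drawn_top`). There, either some point of `H` has many points of `H` to its lower right,
  and after the heavier subtree is put into the left pocket the previous case applies to the lighter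
  one; or `H` is almost increasing (`Pockets.drawn_small_right`).
* Along an almost increasing set the spine can run to the lower left, with the ray to the right of
  each of its points free, so that subtrees may be put into the left pocket all the time
  (`Pockets.rightFree`). Each of them that is not tiny increases the relative size of the pockets by
  a fixed amount, so after boundedly many steps both subtrees fit. A tiny one is drawn on the points
  of `H` themselves, and the rest of the spine is then unrestricted.

The exponent enters through the inequalities `13 * f p + 10 * f q ≤ 10 * f n` and
`20 * f p + 10 * f q ≤ 13 * f n` for `p ≤ q`, `p + q < n`. With `f n` proportional to `n ^ s`, in
the extreme case `p = q = n / 2` they read `23 / 10 ≤ 2 ^ s` and `30 / 13 ≤ 2 ^ s`, and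
`2 ^ 1.22 > 30 / 13`.
-/

section

open Finset BinaryTree

variable {α : Type*}

/-! ### L-shaped paths in coordinates -/

theorem mem_LPath {p q z : ℝ × ℝ} : z ∈ LPath p q ↔
    (z.2 = p.2 ∧ z.1 ∈ Set.uIcc p.1 q.1) ∨ (z.1 = q.1 ∧ z.2 ∈ Set.uIcc p.2 q.2) := by
  have h1 : segment ℝ p (q.1, p.2) = (fun x => (x, p.2)) '' segment ℝ p.1 q.1 := by
    rw [Prod.image_mk_segment_left]
  have h2 : segment ℝ (q.1, p.2) q = (fun y => (q.1, y)) '' segment ℝ p.2 q.2 := by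
    rw [Prod.image_mk_segment_right]
  rw [LPath, h1, h2, segment_eq_uIcc, segment_eq_uIcc]
  constructor
  · rintro (⟨x, hx, rfl⟩ | ⟨y, hy, rfl⟩)
    · exact Or.inl ⟨rfl, hx⟩
    · exact Or.inr ⟨rfl, hy⟩
  · rintro (⟨h, hx⟩ | ⟨h, hy⟩)
    · exact Or.inl ⟨z.1, hx, Prod.ext rfl h.symm⟩
    · exact Or.inr ⟨z.2, hy, Prod.ext h.symm rfl⟩

theorem left_mem_LPath (p q : ℝ × ℝ) : p ∈ LPath p q := by simp [mem_LPath]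

theorem right_mem_LPath (p q : ℝ × ℝ) : q ∈ LPath p q := by simp [mem_LPath]

/-- `σ * x` runs through `x` or `-x`: the two orientations of the horizontal axis. -/
def IsSign (σ : ℝ) : Prop := σ = 1 ∨ σ = -1

theorem IsSign.neg {σ : ℝ} (h : IsSign σ) : IsSign (-σ) := by
  rcases h with rfl | rfl <;> simp [IsSign]

/-- The coordinates of a point of the L-shaped path that leaves `p` horizontally and descends to
`q`. -/
theorem mem_LPath_down {σ : ℝ} (hσ : IsSign σ) {p q z : ℝ × ℝ} (hx : σ * q.1 ≤ σ * p.1)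
    (hy : q.2 ≤ p.2) (hz : z ∈ LPath p q) :
    (z.2 = p.2 ∧ σ * q.1 ≤ σ * z.1 ∧ σ * z.1 ≤ σ * p.1) ∨
      (z.1 = q.1 ∧ q.2 ≤ z.2 ∧ z.2 ≤ p.2) := by
  rw [mem_LPath, Set.uIcc_of_ge hy] at hz
  rcases hσ with rfl | rfl
  · rw [Set.uIcc_of_ge (by linarith)] at hz
    rcases hz with ⟨h, h1, h2⟩ | ⟨h, h1, h2⟩
    · exact Or.inl ⟨h, by linarith, by linarith⟩
    · exact Or.inr ⟨h, h1, h2⟩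
  · rw [Set.uIcc_of_le (by linarith)] at hz
    rcases hz with ⟨h, h1, h2⟩ | ⟨h, h1, h2⟩
    · exact Or.inl ⟨h, by linarith, by linarith⟩
    · exact Or.inr ⟨h, h1, h2⟩

/-- The coordinates of a point of the L-shaped path that leaves `q` horizontally and ascends to
`p`. -/
theorem mem_LPath_up {σ : ℝ} (hσ : IsSign σ) {p q z : ℝ × ℝ} (hx : σ * q.1 ≤ σ * p.1)
    (hy : q.2 ≤ p.2) (hz : z ∈ LPath q p) :
    (z.2 = q.2 ∧ σ * q.1 ≤ σ * z.1 ∧ σ * z.1 ≤ σ * p.1) ∨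
      (z.1 = p.1 ∧ q.2 ≤ z.2 ∧ z.2 ≤ p.2) := by
  rw [mem_LPath, Set.uIcc_of_le hy] at hz
  rcases hσ with rfl | rfl
  · rw [Set.uIcc_of_le (by linarith)] at hz
    rcases hz with ⟨h, h1, h2⟩ | ⟨h, h1, h2⟩
    · exact Or.inl ⟨h, by linarith, by linarith⟩
    · exact Or.inr ⟨h, h1, h2⟩
  · rw [Set.uIcc_of_ge (by linarith)] at hz
    rcases hz with ⟨h, h1, h2⟩ | ⟨h, h1, h2⟩
    · exact Or.inl ⟨h, by linarith, by linarith⟩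
    · exact Or.inr ⟨h, h1, h2⟩

/-! ### Drawings of binary trees -/


/-- `Branch S t p K`: the binary tree `t`, with its vertices at points of `S`, is drawn hanging
from the point `p`, which is not a vertex of `t` but the point of the parent of its root; `K` is
the set of points covered by the drawing, the edge from `p` to the root included. The empty tree
covers `p` alone. The labels of `t` play no role. -/
def Branch (S : Set (ℝ × ℝ)) : BinaryTree α → ℝ × ℝ → Set (ℝ × ℝ) → Prop
  | .nil, p, K => K = {p}
  | .node _ l r, p, K => ∃ q ∈ S, ∃ Kl Kr e : Set (ℝ × ℝ),
      Branch S l q Kl ∧ Branch S r q Kr ∧ Kl ∩ Kr ⊆ {q} ∧ (e = LPath p q ∨ e = LPath q p) ∧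
      p ≠ q ∧ e ∩ (Kl ∪ Kr) ⊆ {q} ∧ K = e ∪ (Kl ∪ Kr)

/-- `Drawn S t q K`: the nonempty binary tree `t` is drawn with its vertices at points of `S`, with
its root at `q`, and the drawing covers the set `K`. -/
def Drawn (S : Set (ℝ × ℝ)) : BinaryTree α → ℝ × ℝ → Set (ℝ × ℝ) → Prop
  | .nil, _, _ => False
  | .node _ l r, q, K => q ∈ S ∧ ∃ Kl Kr : Set (ℝ × ℝ),
      Branch S l q Kl ∧ Branch S r q Kr ∧ Kl ∩ Kr ⊆ {q} ∧ K = Kl ∪ Kr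

theorem Branch.mono {S S' : Set (ℝ × ℝ)} (hS : S ⊆ S') {t : BinaryTree α} {p : ℝ × ℝ}
    {K : Set (ℝ × ℝ)} (h : Branch S t p K) : Branch S' t p K := by
  induction t generalizing p K with
  | nil => exact h
  | node a l r hl hr =>
    obtain ⟨q, hq, Kl, Kr, e, h1, h2, h3⟩ := h
    exact ⟨q, hS hq, Kl, Kr, e, hl h1, hr h2, h3⟩

theorem Drawn.mono {S S' : Set (ℝ × ℝ)} (hS : S ⊆ S') {t : BinaryTree α} {p : ℝ × ℝ}
    {K : Set (ℝ × ℝ)} (h : Drawn S t p K) : Drawn S' t p K := by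
  cases t with
  | nil => exact h
  | node a l r =>
    obtain ⟨hq, Kl, Kr, h1, h2, h3⟩ := h
    exact ⟨hS hq, Kl, Kr, h1.mono hS, h2.mono hS, h3⟩

theorem Branch.mem {S : Set (ℝ × ℝ)} {t : BinaryTree α} {p : ℝ × ℝ} {K : Set (ℝ × ℝ)}
    (h : Branch S t p K) : p ∈ K := by
  cases t with
  | nil => rw [show K = {p} from h]; rfl
  | node a l r =>
    obtain ⟨q, _, Kl, Kr, e, _, _, _, he, _, _, rfl⟩ := h
    left
    rcases he with rfl | rfl
    exacts [left_mem_LPath _ _, right_mem_LPath _ _]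

theorem Drawn.root_mem {S : Set (ℝ × ℝ)} {t : BinaryTree α} {q : ℝ × ℝ} {K : Set (ℝ × ℝ)}
    (h : Drawn S t q K) : q ∈ S := by
  cases t with
  | nil => exact h.elim
  | node a l r => exact h.1

theorem Drawn.mem {S : Set (ℝ × ℝ)} {t : BinaryTree α} {q : ℝ × ℝ} {K : Set (ℝ × ℝ)}
    (h : Drawn S t q K) : q ∈ K := by
  cases t with
  | nil => exact h.elim
  | node a l r =>
    obtain ⟨_, Kl, Kr, h1, _, _, rfl⟩ := h
    exact Or.inl h1.mem

theorem Drawn.branch {S : Set (ℝ × ℝ)} {t : BinaryTree α} {p q : ℝ × ℝ} {K e : Set (ℝ × ℝ)}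
    (h : Drawn S t q K) (he : e = LPath p q ∨ e = LPath q p) (hpq : p ≠ q)
    (hK : e ∩ K ⊆ {q}) : Branch S t p (e ∪ K) := by
  cases t with
  | nil => exact h.elim
  | node a l r =>
    obtain ⟨hq, Kl, Kr, h1, h2, h3, rfl⟩ := h
    exact ⟨q, hq, Kl, Kr, e, h1, h2, h3, he, hpq, hK, rfl⟩

theorem Drawn.swap {S : Set (ℝ × ℝ)} {a : α} {l r : BinaryTree α} {q : ℝ × ℝ} {K : Set (ℝ × ℝ)}
    (h : Drawn S (.node a l r) q K) : Drawn S (.node a r l) q K := by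
  obtain ⟨hq, Kl, Kr, h1, h2, h3, rfl⟩ := h
  exact ⟨hq, Kr, Kl, h2, h1, by rwa [Set.inter_comm], Set.union_comm _ _⟩

/-- Drawings are carried along by injections of the plane that preserve L-shaped paths. -/
theorem Branch.image {S : Set (ℝ × ℝ)} {φ : ℝ × ℝ → ℝ × ℝ} (hφ : Function.Injective φ)
    (hL : ∀ p q, φ '' LPath p q = LPath (φ p) (φ q) ∨ φ '' LPath p q = LPath (φ q) (φ p))
    {t : BinaryTree α} {p : ℝ × ℝ} {K : Set (ℝ × ℝ)} (h : Branch S t p K) :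
    Branch (φ '' S) t (φ p) (φ '' K) := by
  induction t generalizing p K with
  | nil => rw [show K = {p} from h]; exact Set.image_singleton
  | node a l r hl hr =>
    obtain ⟨q, hq, Kl, Kr, e, h1, h2, h3, he, hpq, hK, rfl⟩ := h
    refine ⟨φ q, Set.mem_image_of_mem _ hq, φ '' Kl, φ '' Kr, φ '' e, hl h1, hr h2, ?_, ?_,
      hφ.ne hpq, ?_, by simp only [Set.image_union]⟩
    · rw [← Set.image_inter hφ, ← Set.image_singleton]
      exact Set.image_mono h3
    · rcases he with rfl | rfl
      · exact hL p q
      · exact (hL q p).symm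
    · rw [← Set.image_union, ← Set.image_inter hφ, ← Set.image_singleton]
      exact Set.image_mono hK

theorem Drawn.image {S : Set (ℝ × ℝ)} {φ : ℝ × ℝ → ℝ × ℝ} (hφ : Function.Injective φ)
    (hL : ∀ p q, φ '' LPath p q = LPath (φ p) (φ q) ∨ φ '' LPath p q = LPath (φ q) (φ p))
    {t : BinaryTree α} {p : ℝ × ℝ} {K : Set (ℝ × ℝ)} (h : Drawn S t p K) :
    Drawn (φ '' S) t (φ p) (φ '' K) := by
  cases t with
  | nil => exact h
  | node a l r =>
    obtain ⟨hq, Kl, Kr, h1, h2, h3, rfl⟩ := h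
    refine ⟨Set.mem_image_of_mem _ hq, φ '' Kl, φ '' Kr, h1.image hφ hL, h2.image hφ hL, ?_,
      by simp only [Set.image_union]⟩
    rw [← Set.image_inter hφ, ← Set.image_singleton]
    exact Set.image_mono h3

/-- A drawing that stays below `p`, with nothing above its root, can be hung from `p` by the edge
that leaves `p` horizontally. -/
theorem Drawn.branch_down {S : Set (ℝ × ℝ)} {t : BinaryTree α} {p q : ℝ × ℝ} {K : Set (ℝ × ℝ)}
    (h : Drawn S t q K) (hK : ∀ z ∈ K, z.2 < p.2) (hq : ∀ z ∈ K, z.1 = q.1 → z.2 ≤ q.2) :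
    Branch S t p (LPath p q ∪ K) := by
  have hlt := hK q h.mem
  refine h.branch (Or.inl rfl) (fun e => by rw [e] at hlt; exact lt_irrefl _ hlt) ?_
  rintro z ⟨hz, hzK⟩
  have h1 := hK z hzK
  have h2 := hq z hzK
  rw [mem_LPath, Set.uIcc_of_ge hlt.le] at hz
  rcases hz with ⟨h3, _⟩ | ⟨h3, h4, _⟩
  · exact absurd h3 h1.ne
  · exact Prod.ext h3 (le_antisymm (h2 h3) h4)

/-- A drawing whose root has nothing beside it, on the side of `p`, can be hung from `p` by the
edge that leaves `p` vertically. -/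
theorem Drawn.branch_side {S : Set (ℝ × ℝ)} {t : BinaryTree α} {p q : ℝ × ℝ} {K : Set (ℝ × ℝ)}
    {σ : ℝ} (hσ : IsSign σ) (h : Drawn S t q K) (hx : σ * q.1 < σ * p.1) (hy : q.2 ≤ p.2)
    (hK : ∀ z ∈ K, z.1 = p.1 → z.2 ≤ q.2) (hq : ∀ z ∈ K, z.2 = q.2 → σ * z.1 ≤ σ * q.1) :
    Branch S t p (LPath q p ∪ K) := by
  refine h.branch (Or.inr rfl) (fun e => by rw [e] at hx; exact lt_irrefl _ hx) ?_
  rintro z ⟨hz, hzK⟩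
  have h1 := hK z hzK
  have h2 := hq z hzK
  rcases mem_LPath_up hσ hx.le hy hz with ⟨h3, h4, _⟩ | ⟨h3, h4, _⟩
  · have h5 := le_antisymm (h2 h3) h4
    refine Prod.ext ?_ h3
    rcases hσ with rfl | rfl <;> linarith
  · have h5 := h2 (le_antisymm (h1 h3) h4)
    rw [h3] at h5
    linarith

/-! ### Bounding boxes -/

/-- `z` lies in the bounding box of `S`. -/
def InBox (S : Set (ℝ × ℝ)) (z : ℝ × ℝ) : Prop :=
  (∃ a ∈ S, a.1 ≤ z.1) ∧ (∃ a ∈ S, z.1 ≤ a.1) ∧ (∃ a ∈ S, a.2 ≤ z.2) ∧ ∃ a ∈ S, z.2 ≤ a.2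

theorem InBox.mono {S S' : Set (ℝ × ℝ)} (hS : S ⊆ S') {z : ℝ × ℝ} (h : InBox S z) :
    InBox S' z := by
  obtain ⟨⟨a, ha, h1⟩, ⟨b, hb, h2⟩, ⟨c, hc, h3⟩, ⟨d, hd, h4⟩⟩ := h
  exact ⟨⟨a, hS ha, h1⟩, ⟨b, hS hb, h2⟩, ⟨c, hS hc, h3⟩, ⟨d, hS hd, h4⟩⟩

theorem inBox_iff {σ : ℝ} (hσ : IsSign σ) {S : Set (ℝ × ℝ)} {z : ℝ × ℝ} : InBox S z ↔
    (∃ a ∈ S, σ * a.1 ≤ σ * z.1) ∧ (∃ a ∈ S, σ * z.1 ≤ σ * a.1) ∧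
      (∃ a ∈ S, a.2 ≤ z.2) ∧ ∃ a ∈ S, z.2 ≤ a.2 := by
  rcases hσ with rfl | rfl
  · simp only [one_mul, InBox]
  · simp only [neg_one_mul, neg_le_neg_iff, InBox]
    tauto

theorem inBox_self {S : Set (ℝ × ℝ)} {z : ℝ × ℝ} (hz : z ∈ S) : InBox S z :=
  ⟨⟨z, hz, le_rfl⟩, ⟨z, hz, le_rfl⟩, ⟨z, hz, le_rfl⟩, ⟨z, hz, le_rfl⟩⟩

/-- `t` is drawn on `S` inside the bounding box of `S`, with its root `q` as a highest point of the
drawing. -/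
structure TopDrawn (S : Set (ℝ × ℝ)) (t : BinaryTree α) (q : ℝ × ℝ) (K : Set (ℝ × ℝ)) :
    Prop where
  drawn : Drawn S t q K
  inBox : ∀ z ∈ K, InBox S z
  le : ∀ z ∈ K, z.2 ≤ q.2

theorem TopDrawn.mono {S S' : Set (ℝ × ℝ)} (hS : S ⊆ S') {t : BinaryTree α} {p : ℝ × ℝ}
    {K : Set (ℝ × ℝ)} (h : TopDrawn S t p K) : TopDrawn S' t p K :=
  ⟨h.drawn.mono hS, fun z hz => (h.inBox z hz).mono hS, h.le⟩

theorem TopDrawn.swap {S : Set (ℝ × ℝ)} {a : α} {l r : BinaryTree α} {q : ℝ × ℝ}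
    {K : Set (ℝ × ℝ)} (h : TopDrawn S (.node a l r) q K) : TopDrawn S (.node a r l) q K :=
  ⟨h.drawn.swap, h.inBox, h.le⟩

theorem topDrawn_single {S : Set (ℝ × ℝ)} {a : α} {q : ℝ × ℝ} (hq : q ∈ S) :
    TopDrawn S (.node a .nil .nil) q {q} :=
  ⟨⟨hq, {q}, {q}, rfl, rfl, by simp, by simp⟩, fun z hz => by
    rw [show z = q from hz]; exact inBox_self hq, fun z hz => by rw [show z = q from hz]⟩

/-! ### Point sets in general orthogonal position -/

theorem GeneralOrthogonalPosition.subset {P Q : Finset (ℝ × ℝ)}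
    (h : GeneralOrthogonalPosition P) (hQ : Q ⊆ P) : GeneralOrthogonalPosition Q :=
  fun p hp q hq => h p (hQ hp) q (hQ hq)

theorem GeneralOrthogonalPosition.injOn_snd {P : Finset (ℝ × ℝ)}
    (h : GeneralOrthogonalPosition P) : Set.InjOn (fun z : ℝ × ℝ => z.2) P := by
  intro p hp q hq hpq
  by_contra hne
  exact (h p hp q hq hne).2 hpq

theorem GeneralOrthogonalPosition.injOn_mul_fst {P : Finset (ℝ × ℝ)}
    (h : GeneralOrthogonalPosition P) {σ : ℝ} (hσ : IsSign σ) :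
    Set.InjOn (fun z : ℝ × ℝ => σ * z.1) P := by
  intro p hp q hq hpq
  by_contra hne
  have h0 : σ ≠ 0 := by rcases hσ with rfl | rfl <;> norm_num
  exact (h p hp q hq hne).1 (mul_left_cancel₀ h0 hpq)

/-- The `m` elements of `S` at which `k` is smallest. -/
theorem exists_subset_card_eq_lt (k : ℝ × ℝ → ℝ) {S : Finset (ℝ × ℝ)} (hk : Set.InjOn k S) {m : ℕ}
    (hm : m ≤ S.card) : ∃ T ⊆ S, T.card = m ∧ ∀ a ∈ T, ∀ b ∈ S \ T, k a < k b := by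
  induction m with
  | zero => exact ⟨∅, empty_subset _, rfl, by simp⟩
  | succ m ih =>
    obtain ⟨T, hT, hc, hlt⟩ := ih (by omega)
    have hne : (S \ T).Nonempty := by
      rw [← card_pos, card_sdiff_of_subset hT]; omega
    obtain ⟨x, hx, hmin⟩ := exists_min_image (S \ T) k hne
    rw [mem_sdiff] at hx
    refine ⟨insert x T, insert_subset hx.1 hT, by rw [card_insert_of_notMem hx.2, hc], ?_⟩
    intro a ha b hb
    rw [mem_sdiff, mem_insert, not_or] at hb
    rcases mem_insert.1 ha with rfl | ha
    · refine lt_of_le_of_ne (hmin b (mem_sdiff.2 ⟨hb.1, hb.2.2⟩)) fun h => hb.2.1 ?_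
      exact (hk hx.1 hb.1 h).symm
    · exact hlt a ha b (mem_sdiff.2 ⟨hb.1, hb.2.2⟩)

/-- A highest point of a nonempty set in general orthogonal position lies above all others. -/
theorem GeneralOrthogonalPosition.exists_top {S : Finset (ℝ × ℝ)}
    (h : GeneralOrthogonalPosition S) (hne : S.Nonempty) :
    ∃ v ∈ S, ∀ b ∈ S, b ≠ v → b.2 < v.2 := by
  obtain ⟨v, hv, hmax⟩ := exists_max_image S (fun z => z.2) hne
  exact ⟨v, hv, fun b hb hbv => lt_of_le_of_ne (hmax b hb) (h b hb v hv hbv).2⟩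

/-! ### Hanging subtrees -/

/-- Every nonempty binary tree with `m < N` nodes can be drawn on every set of at least `f m`
points in general orthogonal position, inside the bounding box of this set and with its root as a
highest point. -/
def TopDrawable (α : Type*) (f : ℕ → ℕ) (N : ℕ) : Prop :=
  ∀ t : BinaryTree α, t ≠ .nil → t.numNodes < N →
    ∀ S : Finset (ℝ × ℝ), GeneralOrthogonalPosition S → f t.numNodes ≤ S.card →
      ∃ (q : ℝ × ℝ) (K : Set (ℝ × ℝ)), TopDrawn S t q K

theorem image_LPath_swap {σ : ℝ} (hσ : IsSign σ) (p q : ℝ × ℝ) :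
    (fun z : ℝ × ℝ => (σ * z.2, z.1)) '' LPath p q = LPath (σ * q.2, q.1) (σ * p.2, p.1) := by
  ext ⟨x, y⟩
  have h : (x, y) ∈ (fun z : ℝ × ℝ => (σ * z.2, z.1)) '' LPath p q ↔ (y, σ * x) ∈ LPath p q := by
    constructor
    · rintro ⟨⟨u, v⟩, hz, he⟩
      simp only [Prod.mk.injEq] at he
      obtain ⟨rfl, rfl⟩ := he
      rcases hσ with rfl | rfl <;> simpa using hz
    · intro hz
      refine ⟨_, hz, ?_⟩
      rcases hσ with rfl | rfl <;> simp
  rw [h, mem_LPath, mem_LPath]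
  simp only [Set.mem_uIcc]
  rcases hσ with rfl | rfl <;> grind

/-- The transposition of the plane turns a highest point into a `σ`-rightmost one. -/
theorem TopDrawable.side {f : ℕ → ℕ} {N : ℕ} (hU : TopDrawable α f N) {σ : ℝ} (hσ : IsSign σ)
    (t : BinaryTree α) (ht : t ≠ .nil) (hN : t.numNodes < N) (S : Finset (ℝ × ℝ))
    (hS : GeneralOrthogonalPosition S) (hc : f t.numNodes ≤ S.card) :
    ∃ (q : ℝ × ℝ) (K : Set (ℝ × ℝ)), Drawn S t q K ∧ (∀ z ∈ K, InBox S z) ∧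
      ∀ z ∈ K, σ * z.1 ≤ σ * q.1 := by
  set ψ : ℝ × ℝ → ℝ × ℝ := fun z => (z.2, σ * z.1) with hψ
  set φ : ℝ × ℝ → ℝ × ℝ := fun z => (σ * z.2, z.1) with hφ
  have hσ2 : σ * σ = 1 := by rcases hσ with rfl | rfl <;> norm_num
  have hφψ : ∀ z, φ (ψ z) = z := fun z => by
    simp only [hφ, hψ, ← mul_assoc, hσ2, one_mul]
  have hψφ : ∀ z, ψ (φ z) = z := fun z => by
    simp only [hφ, hψ, ← mul_assoc, hσ2, one_mul]
  have hψi : Function.Injective ψ := Function.LeftInverse.injective hφψ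
  have hφi : Function.Injective φ := Function.LeftInverse.injective hψφ
  have hG : GeneralOrthogonalPosition (S.image ψ) := by
    intro p hp q hq hpq
    obtain ⟨a, ha, rfl⟩ := mem_image.1 hp
    obtain ⟨b, hb, rfl⟩ := mem_image.1 hq
    have hab : a ≠ b := fun h => hpq (by rw [h])
    refine ⟨(hS a ha b hb hab).2, fun h => hab ?_⟩
    exact hS.injOn_mul_fst hσ ha hb h
  obtain ⟨q, K, hd, hb, hu⟩ := hU t ht hN (S.image ψ) hG (by rwa [card_image_of_injective _ hψi])
  have himg : φ '' ((S.image ψ : Finset (ℝ × ℝ)) : Set (ℝ × ℝ)) = S := by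
    rw [coe_image, Set.image_image]
    simp only [hφψ, Set.image_id']
  refine ⟨φ q, φ '' K, ?_, ?_, ?_⟩
  · rw [← himg]
    exact hd.image hφi fun p q => Or.inr (image_LPath_swap hσ p q)
  · rintro _ ⟨z, hz, rfl⟩
    obtain ⟨⟨a, ha, h1⟩, ⟨b, hb, h2⟩, ⟨c, hc, h3⟩, ⟨d, hd, h4⟩⟩ := hb z hz
    rw [coe_image] at ha hb hc hd
    obtain ⟨a, ha, rfl⟩ := ha
    obtain ⟨b, hb, rfl⟩ := hb
    obtain ⟨c, hc, rfl⟩ := hc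
    obtain ⟨d, hd, rfl⟩ := hd
    simp only [hψ] at h1 h2 h3 h4
    rw [inBox_iff hσ]
    simp only [hφ, ← mul_assoc, hσ2, one_mul]
    exact ⟨⟨c, hc, h3⟩, ⟨d, hd, h4⟩, ⟨a, ha, h1⟩, ⟨b, hb, h2⟩⟩
  · rintro _ ⟨z, hz, rfl⟩
    simp only [hφ, ← mul_assoc, hσ2, one_mul]
    exact hu z hz

/-- A subtree drawn in a pocket `S` below `p`, on one side of it, and hung from `p` by the edge that
leaves `p` horizontally. -/
theorem TopDrawable.exists_branch_down {f : ℕ → ℕ} {N : ℕ} (hU : TopDrawable α f N) {σ : ℝ}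
    (hσ : IsSign σ) {t : BinaryTree α} (hN : t.numNodes < N) {S : Finset (ℝ × ℝ)}
    (hS : GeneralOrthogonalPosition S) (hc : f t.numNodes ≤ S.card) {p : ℝ × ℝ}
    (hx : ∀ a ∈ S, σ * a.1 < σ * p.1) (hy : ∀ a ∈ S, a.2 < p.2) :
    ∃ K, Branch S t p K ∧ ∀ z ∈ K, z = p ∨ (∃ a ∈ S, σ * a.1 ≤ σ * z.1) ∧ σ * z.1 < σ * p.1 ∧
      (∃ a ∈ S, a.2 ≤ z.2) ∧ (z.2 = p.2 ∨ z.2 < p.2 ∧ ∃ a ∈ S, σ * z.1 ≤ σ * a.1) := by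
  cases t with
  | nil => exact ⟨{p}, rfl, fun z hz => Or.inl hz⟩
  | node a l r =>
    obtain ⟨q, K, hd, hb, hu⟩ := hU _ (by simp) hN S hS hc
    have hqS : q ∈ S := hd.root_mem
    refine ⟨LPath p q ∪ K, hd.branch_down (fun z hz => ?_) fun z hz _ => hu z hz, ?_⟩
    · obtain ⟨_, _, _, ⟨d, hd, h4⟩⟩ := hb z hz
      exact h4.trans_lt (hy d hd)
    · rintro z (hz | hz)
      · rcases mem_LPath_down hσ (hx q hqS).le (hy q hqS).le hz with ⟨h1, h2, h3⟩ | ⟨h1, h2, h3⟩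
        · rcases h3.eq_or_lt with h3 | h3
          · left
            refine Prod.ext ?_ h1
            rcases hσ with rfl | rfl <;> linarith
          · exact Or.inr ⟨⟨q, hqS, h2⟩, h3, ⟨q, hqS, by rw [h1]; exact (hy q hqS).le⟩, Or.inl h1⟩
        · refine Or.inr ⟨⟨q, hqS, by rw [h1]⟩, by rw [h1]; exact hx q hqS, ⟨q, hqS, h2⟩, ?_⟩
          rcases h3.eq_or_lt with h3 | h3
          · exact Or.inl h3
          · exact Or.inr ⟨h3, q, hqS, by rw [h1]⟩
      · obtain ⟨h1, ⟨b, hb, h2⟩, h3, ⟨d, hd, h4⟩⟩ := (inBox_iff hσ).1 (hb z hz)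
        exact Or.inr ⟨h1, h2.trans_lt (hx b hb), h3, Or.inr ⟨h4.trans_lt (hy d hd), b, hb, h2⟩⟩

/-- A subtree drawn in a pocket `S` below `p`, on one side of it, and hung from `p` by the edge that
leaves `p` vertically. -/
theorem TopDrawable.exists_branch_side {f : ℕ → ℕ} {N : ℕ} (hU : TopDrawable α f N) {σ : ℝ}
    (hσ : IsSign σ) {t : BinaryTree α} (hN : t.numNodes < N) {S : Finset (ℝ × ℝ)}
    (hS : GeneralOrthogonalPosition S) (hc : f t.numNodes ≤ S.card) {p : ℝ × ℝ}
    (hx : ∀ a ∈ S, σ * a.1 < σ * p.1) (hy : ∀ a ∈ S, a.2 < p.2) :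
    ∃ K, Branch S t p K ∧ ∀ z ∈ K, z = p ∨ (∃ a ∈ S, σ * a.1 ≤ σ * z.1) ∧ σ * z.1 ≤ σ * p.1 ∧
      (∃ a ∈ S, a.2 ≤ z.2) ∧ z.2 < p.2 ∧ (z.1 = p.1 ∨ ∃ a ∈ S, z.2 ≤ a.2) := by
  cases t with
  | nil => exact ⟨{p}, rfl, fun z hz => Or.inl hz⟩
  | node a l r =>
    obtain ⟨q, K, hd, hb, hu⟩ := hU.side hσ _ (by simp) hN S hS hc
    have hqS : q ∈ S := hd.root_mem
    refine ⟨LPath q p ∪ K, hd.branch_side hσ (hx q hqS) (hy q hqS).le (fun z hz h => ?_)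
      fun z hz _ => hu z hz, ?_⟩
    · obtain ⟨_, ⟨b, hb, h2⟩, _, _⟩ := (inBox_iff hσ).1 (hb z hz)
      have := hx b hb
      rw [h] at h2
      linarith
    · rintro z (hz | hz)
      · rcases mem_LPath_up hσ (hx q hqS).le (hy q hqS).le hz with ⟨h1, h2, h3⟩ | ⟨h1, h2, h3⟩
        · exact Or.inr ⟨⟨q, hqS, h2⟩, h3, ⟨q, hqS, by rw [h1]⟩, by rw [h1]; exact hy q hqS,
            Or.inr ⟨q, hqS, by rw [h1]⟩⟩
        · rcases h3.eq_or_lt with h3 | h3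
          · exact Or.inl (Prod.ext h1 h3)
          · exact Or.inr ⟨⟨q, hqS, by rw [h1]; exact (hx q hqS).le⟩, by rw [h1], ⟨q, hqS, h2⟩, h3,
              Or.inl h1⟩
      · obtain ⟨h1, ⟨b, hb, h2⟩, h3, ⟨d, hd, h4⟩⟩ := (inBox_iff hσ).1 (hb z hz)
        exact Or.inr ⟨h1, h2.trans (hx b hb).le, h3, h4.trans_lt (hy d hd), Or.inr ⟨d, hd, h4⟩⟩

/-! ### Assembling the two subtrees at a vertex -/

/-- One subtree hangs in a pocket on the `σ`-left of `v`, the other one in a pocket on the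
`σ`-right of `v`, attached vertically. The `σ`-right ray at `v` remains free. -/
theorem TopDrawable.drawn_opposite {f : ℕ → ℕ} {N : ℕ} (hU : TopDrawable α f N) {σ : ℝ}
    (hσ : IsSign σ) {a : α} {l r : BinaryTree α} (hl : l.numNodes < N) (hr : r.numNodes < N)
    {S₁ S₂ : Finset (ℝ × ℝ)} (h₁ : GeneralOrthogonalPosition S₁)
    (h₂ : GeneralOrthogonalPosition S₂) (hc₁ : f l.numNodes ≤ S₁.card)
    (hc₂ : f r.numNodes ≤ S₂.card) {v : ℝ × ℝ} (hx₁ : ∀ a ∈ S₁, σ * a.1 < σ * v.1)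
    (hy₁ : ∀ a ∈ S₁, a.2 < v.2) (hx₂ : ∀ a ∈ S₂, σ * v.1 < σ * a.1)
    (hy₂ : ∀ a ∈ S₂, a.2 < v.2) {T : Set (ℝ × ℝ)} (hT₁ : ↑S₁ ⊆ T) (hT₂ : ↑S₂ ⊆ T)
    (hv : v ∈ T) :
    ∃ K, TopDrawn T (.node a l r) v K ∧ (∀ z ∈ K, z.2 = v.2 → σ * z.1 ≤ σ * v.1) ∧
      ∀ z ∈ K, σ * z.1 ≤ σ * v.1 ∨ ∃ a ∈ S₂, z.2 ≤ a.2 := by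
  obtain ⟨K₁, hb₁, hK₁⟩ := hU.exists_branch_down hσ hl h₁ hc₁ hx₁ hy₁
  obtain ⟨K₂, hb₂, hK₂⟩ := hU.exists_branch_side hσ.neg hr h₂ hc₂ (p := v)
    (fun a ha => by have := hx₂ a ha; linarith) hy₂
  refine ⟨K₁ ∪ K₂, ⟨⟨hv, K₁, K₂, hb₁.mono hT₁, hb₂.mono hT₂, ?_, rfl⟩, ?_, ?_⟩, ?_, ?_⟩
  · rintro z ⟨hz₁, hz₂⟩
    rcases hK₁ z hz₁ with h | ⟨-, h, -⟩
    · exact h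
    · rcases hK₂ z hz₂ with h' | ⟨-, h', -⟩
      · exact h'
      · linarith
  · rintro z (hz | hz)
    · rcases hK₁ z hz with rfl | ⟨⟨b, hb, h1⟩, h2, ⟨c, hc, h3⟩, h4⟩
      · exact inBox_self hv
      · refine (inBox_iff hσ).2 ⟨⟨b, hT₁ hb, h1⟩, ⟨v, hv, h2.le⟩, ⟨c, hT₁ hc, h3⟩, v, hv, ?_⟩
        rcases h4 with h4 | h4
        · exact h4.le
        · exact h4.1.le
    · rcases hK₂ z hz with rfl | ⟨⟨b, hb, h1⟩, h2, ⟨c, hc, h3⟩, h4, -⟩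
      · exact inBox_self hv
      · exact (inBox_iff hσ.neg).2 ⟨⟨b, hT₂ hb, h1⟩, ⟨v, hv, h2⟩, ⟨c, hT₂ hc, h3⟩, v, hv, h4.le⟩
  · rintro z (hz | hz)
    · rcases hK₁ z hz with rfl | ⟨-, -, -, h4 | h4⟩
      exacts [le_rfl, h4.le, h4.1.le]
    · rcases hK₂ z hz with rfl | ⟨-, -, -, h4, -⟩
      exacts [le_rfl, h4.le]
  · rintro z (hz | hz) hzv
    · rcases hK₁ z hz with rfl | ⟨-, h2, -⟩
      exacts [le_rfl, h2.le]
    · rcases hK₂ z hz with rfl | ⟨-, -, -, h4, -⟩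
      exacts [le_rfl, absurd hzv h4.ne]
  · rintro z (hz | hz)
    · rcases hK₁ z hz with rfl | ⟨-, h2, -⟩
      exacts [Or.inl le_rfl, Or.inl h2.le]
    · rcases hK₂ z hz with rfl | ⟨-, -, -, -, h5 | h5⟩
      exacts [Or.inl le_rfl, Or.inl (by rw [h5]), Or.inr h5]

/-- Both subtrees hang in pockets on the `σ`-left of `v`, one above the other; the lower one is
attached vertically. The `σ`-right ray at `v` remains free. -/
theorem TopDrawable.drawn_same {f : ℕ → ℕ} {N : ℕ} (hU : TopDrawable α f N) {σ : ℝ}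
    (hσ : IsSign σ) {a : α} {l r : BinaryTree α} (hl : l.numNodes < N) (hr : r.numNodes < N)
    {S : Finset (ℝ × ℝ)} (hS : GeneralOrthogonalPosition S)
    (hc : f l.numNodes + f r.numNodes ≤ S.card) {v : ℝ × ℝ} (hx : ∀ a ∈ S, σ * a.1 < σ * v.1)
    (hy : ∀ a ∈ S, a.2 < v.2) {T : Set (ℝ × ℝ)} (hT : ↑S ⊆ T) (hv : v ∈ T) :
    ∃ K, TopDrawn T (.node a l r) v K ∧ ∀ z ∈ K, z.2 = v.2 → σ * z.1 ≤ σ * v.1 := by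
  obtain ⟨S₂, hS₂, hc₂, hlt⟩ := exists_subset_card_eq_lt (fun z => z.2) hS.injOn_snd
    (show f r.numNodes ≤ S.card by omega)
  have hS₁ : S \ S₂ ⊆ S := sdiff_subset
  have hc₁ : f l.numNodes ≤ (S \ S₂).card := by rw [card_sdiff_of_subset hS₂]; omega
  have hT₁ : ↑(S \ S₂) ⊆ T := (coe_subset.2 hS₁).trans hT
  have hT₂ : ↑S₂ ⊆ T := (coe_subset.2 hS₂).trans hT
  obtain ⟨K₁, hb₁, hK₁⟩ := hU.exists_branch_down hσ hl (hS.subset hS₁) hc₁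
    (fun a ha => hx a (hS₁ ha)) (fun a ha => hy a (hS₁ ha))
  obtain ⟨K₂, hb₂, hK₂⟩ := hU.exists_branch_side hσ hr (hS.subset hS₂) hc₂.ge
    (fun a ha => hx a (hS₂ ha)) (fun a ha => hy a (hS₂ ha))
  refine ⟨K₁ ∪ K₂, ⟨⟨hv, K₁, K₂, hb₁.mono hT₁, hb₂.mono hT₂, ?_, rfl⟩, ?_, ?_⟩, ?_⟩
  · rintro z ⟨hz₁, hz₂⟩
    rcases hK₁ z hz₁ with h | ⟨-, h, ⟨b, hb, h1⟩, -⟩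
    · exact h
    · rcases hK₂ z hz₂ with h' | ⟨-, -, -, -, h' | ⟨c, hc, h2⟩⟩
      · exact h'
      · rw [h'] at h; exact absurd h (lt_irrefl _)
      · have := hlt c hc b hb
        linarith
  · rintro z (hz | hz)
    · rcases hK₁ z hz with rfl | ⟨⟨b, hb, h1⟩, h2, ⟨c, hc, h3⟩, h4⟩
      · exact inBox_self hv
      · refine (inBox_iff hσ).2 ⟨⟨b, hT₁ hb, h1⟩, ⟨v, hv, h2.le⟩, ⟨c, hT₁ hc, h3⟩, v, hv, ?_⟩
        rcases h4 with h4 | h4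
        · exact h4.le
        · exact h4.1.le
    · rcases hK₂ z hz with rfl | ⟨⟨b, hb, h1⟩, h2, ⟨c, hc, h3⟩, h4, -⟩
      · exact inBox_self hv
      · exact (inBox_iff hσ).2 ⟨⟨b, hT₂ hb, h1⟩, ⟨v, hv, h2⟩, ⟨c, hT₂ hc, h3⟩, v, hv, h4.le⟩
  · rintro z (hz | hz)
    · rcases hK₁ z hz with rfl | ⟨-, -, -, h4 | h4⟩
      exacts [le_rfl, h4.le, h4.1.le]
    · rcases hK₂ z hz with rfl | ⟨-, -, -, h4, -⟩
      exacts [le_rfl, h4.le]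
  · rintro z (hz | hz) hzv
    · rcases hK₁ z hz with rfl | ⟨-, h2, -⟩
      exacts [le_rfl, h2.le]
    · rcases hK₂ z hz with rfl | ⟨-, h2, -⟩
      exacts [le_rfl, h2]

/-- One subtree hangs in a strip `S` on the `σ`-left of everything else, and the drawing of the
other one lies below `v`. The second edge leaves `v` horizontally if the second root lies on the
`σ`-right of `v`, and vertically if it lies on the `σ`-left of `v`; in the latter case the
`σ`-right ray must be free at the second root, and it is free at `v`. -/
theorem TopDrawable.drawn_strip {f : ℕ → ℕ} {N : ℕ} (hU : TopDrawable α f N) {σ : ℝ}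
    (hσ : IsSign σ) {a : α} {l r : BinaryTree α} (hl : l.numNodes < N)
    {S : Finset (ℝ × ℝ)} (hS : GeneralOrthogonalPosition S)
    (hc : f l.numNodes ≤ S.card) {v : ℝ × ℝ} (hx : ∀ a ∈ S, σ * a.1 < σ * v.1)
    (hy : ∀ a ∈ S, a.2 < v.2) {T' T : Set (ℝ × ℝ)} {q : ℝ × ℝ} {K : Set (ℝ × ℝ)}
    (hK : TopDrawn T' r q K) (hxT : ∀ a ∈ S, ∀ b ∈ T', σ * a.1 < σ * b.1)
    (hyT : ∀ b ∈ T', b.2 < v.2)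
    (hq : σ * v.1 < σ * q.1 ∨
      σ * q.1 < σ * v.1 ∧ ∀ z ∈ K, z.2 = q.2 → σ * z.1 ≤ σ * q.1)
    (hTS : ↑S ⊆ T) (hTT : T' ⊆ T) (hv : v ∈ T) :
    ∃ K', TopDrawn T (.node a l r) v K' ∧
      (σ * q.1 < σ * v.1 → ∀ z ∈ K', z.2 = v.2 → σ * z.1 ≤ σ * v.1) := by
  obtain ⟨K₁, hb₁, hK₁⟩ := hU.exists_branch_down hσ hl hS hc hx hy
  have hqT := hK.drawn.root_mem
  have hqv := hyT q hqT
  have hKv : ∀ z ∈ K, z.2 < v.2 := fun z hz => (hK.le z hz).trans_lt hqv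
  have hKx : ∀ a ∈ S, ∀ z ∈ K, σ * a.1 < σ * z.1 := fun a ha z hz => by
    obtain ⟨⟨b, hb, h1⟩, -⟩ := (inBox_iff hσ).1 (hK.inBox z hz)
    exact (hxT a ha b hb).trans_le h1
  obtain ⟨K₂, hb₂, hK₂⟩ : ∃ K₂, Branch T' r v K₂ ∧ ∀ z ∈ K₂, z = v ∨ z ∈ K ∨
      (σ * v.1 < σ * q.1 ∧ z.2 = v.2 ∧ σ * v.1 ≤ σ * z.1 ∧ σ * z.1 ≤ σ * q.1) ∨
      (z.2 < v.2 ∧ q.2 ≤ z.2 ∧ σ * q.1 ≤ σ * z.1 ∧ (σ * z.1 ≤ σ * v.1 ∨ σ * z.1 ≤ σ * q.1)) := by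
    rcases hq with hq | ⟨hq, hfree⟩
    · refine ⟨_, hK.drawn.branch_down hKv fun z hz _ => hK.le z hz, ?_⟩
      rintro z (hz | hz)
      · rcases mem_LPath_down hσ.neg (by linarith) hqv.le hz with ⟨h1, h2, h3⟩ | ⟨h1, h2, h3⟩
        · exact Or.inr (Or.inr (Or.inl ⟨hq, h1, by linarith, by linarith⟩))
        · rcases h3.eq_or_lt with h3 | h3
          · exact Or.inr (Or.inr (Or.inl ⟨hq, h3, by rw [h1]; exact hq.le, by rw [h1]⟩))
          · exact Or.inr (Or.inr (Or.inr ⟨h3, h2, by rw [h1], Or.inr (by rw [h1])⟩))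
      · exact Or.inr (Or.inl hz)
    · refine ⟨_, hK.drawn.branch_side hσ hq hqv.le (fun z hz _ => hK.le z hz) hfree, ?_⟩
      rintro z (hz | hz)
      · rcases mem_LPath_up hσ hq.le hqv.le hz with ⟨h1, h2, h3⟩ | ⟨h1, h2, h3⟩
        · exact Or.inr (Or.inr (Or.inr ⟨by rw [h1]; exact hqv, h1.ge, h2, Or.inl h3⟩))
        · rcases h3.eq_or_lt with h3 | h3
          · exact Or.inl (Prod.ext h1 h3)
          · exact Or.inr (Or.inr (Or.inr ⟨h3, h2, by rw [h1]; exact hq.le, Or.inl (by rw [h1])⟩))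
      · exact Or.inr (Or.inl hz)
  refine ⟨K₁ ∪ K₂, ⟨⟨hv, K₁, K₂, hb₁.mono hTS, hb₂.mono hTT, ?_, rfl⟩, ?_, ?_⟩, ?_⟩
  · rintro z ⟨hz₁, hz₂⟩
    rcases hK₁ z hz₁ with h | ⟨-, h, -, h'⟩
    · exact h
    rcases hK₂ z hz₂ with h1 | h1 | ⟨-, h1, h2, -⟩ | ⟨h1, -, h2, -⟩
    · exact h1
    · rcases h' with h' | ⟨-, b, hb, h'⟩
      · exact absurd h' (hKv z h1).ne
      · have := hKx b hb z h1
        linarith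
    · linarith
    · rcases h' with h' | ⟨-, b, hb, h'⟩
      · exact absurd h' h1.ne
      · have := hxT b hb q hqT
        linarith
  · rintro z (hz | hz)
    · rcases hK₁ z hz with rfl | ⟨⟨b, hb, h1⟩, h2, ⟨c, hc, h3⟩, h4⟩
      · exact inBox_self hv
      · refine (inBox_iff hσ).2 ⟨⟨b, hTS hb, h1⟩, ⟨v, hv, h2.le⟩, ⟨c, hTS hc, h3⟩, v, hv, ?_⟩
        rcases h4 with h4 | h4
        · exact h4.le
        · exact h4.1.le
    · rcases hK₂ z hz with rfl | h1 | ⟨-, h1, h2, h3⟩ | ⟨h1, h2, h3, h4⟩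
      · exact inBox_self hv
      · exact (hK.inBox z h1).mono hTT
      · exact (inBox_iff hσ).2 ⟨⟨v, hv, h2⟩, ⟨q, hTT hqT, h3⟩, ⟨v, hv, h1.ge⟩, ⟨v, hv, h1.le⟩⟩
      · refine (inBox_iff hσ).2 ⟨⟨q, hTT hqT, h3⟩, ?_, ⟨q, hTT hqT, h2⟩, ⟨v, hv, h1.le⟩⟩
        rcases h4 with h4 | h4
        exacts [⟨v, hv, h4⟩, ⟨q, hTT hqT, h4⟩]
  · rintro z (hz | hz)
    · rcases hK₁ z hz with rfl | ⟨-, -, -, h4 | h4⟩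
      exacts [le_rfl, h4.le, h4.1.le]
    · rcases hK₂ z hz with rfl | h1 | ⟨-, h1, -⟩ | ⟨h1, -⟩
      exacts [le_rfl, (hKv z h1).le, h1.le, h1.le]
  · rintro hqx z (hz | hz) hzv
    · rcases hK₁ z hz with rfl | ⟨-, h2, -⟩
      exacts [le_rfl, h2.le]
    · rcases hK₂ z hz with rfl | h1 | ⟨h1, -⟩ | ⟨h1, -⟩
      · exact le_rfl
      · exact absurd hzv (hKv z h1).ne
      · exact absurd hqx h1.not_gt
      · exact absurd hzv h1.ne

/-- One subtree is hung from `v` so that it stays on the `σ`-right of the root `q` of the other one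
and off its drawing; `q` is below `v`, on the `σ`-left, and its edge leaves `v` horizontally. The
`σ`-right ray at `v` remains free. -/
theorem TopDrawn.drawn_branch {σ : ℝ} (hσ : IsSign σ) {a : α} {l r : BinaryTree α}
    {v q : ℝ × ℝ} {T' T K₁ K : Set (ℝ × ℝ)} (hb : Branch T l v K₁)
    (hK₁ : ∀ z ∈ K₁, z = v ∨ z.2 < v.2 ∧ σ * q.1 < σ * z.1) (hbox : ∀ z ∈ K₁, InBox T z)
    (hK : TopDrawn T' r q K) (hqv : q.2 < v.2) (hqx : σ * q.1 < σ * v.1)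
    (hdisj : ∀ z ∈ K₁, z ∈ K → z = v) (hTT : T' ⊆ T) (hv : v ∈ T) :
    ∃ K', TopDrawn T (.node a l r) v K' ∧ ∀ z ∈ K', z.2 = v.2 → σ * z.1 ≤ σ * v.1 := by
  have hqT := hTT hK.drawn.root_mem
  have hKv : ∀ z ∈ K, z.2 < v.2 := fun z hz => (hK.le z hz).trans_lt hqv
  have hb₂ := hK.drawn.branch_down hKv fun z hz _ => hK.le z hz
  refine ⟨K₁ ∪ (LPath v q ∪ K), ⟨⟨hv, _, _, hb, hb₂.mono hTT, ?_, rfl⟩, ?_, ?_⟩, ?_⟩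
  · rintro z ⟨hz₁, hz | hz⟩
    · rcases hK₁ z hz₁ with h | ⟨h, h'⟩
      · exact h
      · rcases mem_LPath_down hσ hqx.le hqv.le hz with ⟨h1, -⟩ | ⟨h1, -⟩
        · exact absurd h1 h.ne
        · rw [h1] at h'; exact absurd h' (lt_irrefl _)
    · exact hdisj z hz₁ hz
  · rintro z (hz | hz | hz)
    · exact hbox z hz
    · rcases mem_LPath_down hσ hqx.le hqv.le hz with ⟨h1, h2, h3⟩ | ⟨h1, h2, h3⟩
      · exact (inBox_iff hσ).2 ⟨⟨q, hqT, h2⟩, ⟨v, hv, h3⟩, ⟨v, hv, h1.ge⟩, ⟨v, hv, h1.le⟩⟩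
      · exact (inBox_iff hσ).2
          ⟨⟨q, hqT, by rw [h1]⟩, ⟨q, hqT, by rw [h1]⟩, ⟨q, hqT, h2⟩, ⟨v, hv, h3⟩⟩
    · exact (hK.inBox z hz).mono hTT
  · rintro z (hz | hz | hz)
    · rcases hK₁ z hz with rfl | ⟨h, -⟩
      exacts [le_rfl, h.le]
    · rcases mem_LPath_down hσ hqx.le hqv.le hz with ⟨h1, -⟩ | ⟨-, -, h1⟩
      exacts [h1.le, h1]
    · exact (hKv z hz).le
  · rintro z (hz | hz | hz) hzv
    · rcases hK₁ z hz with rfl | ⟨h, -⟩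
      exacts [le_rfl, absurd hzv h.ne]
    · rcases mem_LPath_down hσ hqx.le hqv.le hz with ⟨-, -, h1⟩ | ⟨h1, -⟩
      exacts [h1, by rw [h1]; exact hqx.le]
    · exact absurd hzv (hKv z hz).ne

/-! ### Spines between two pockets -/

/-- The numerical properties of the number `f n` of points sufficient for `n` vertices that the
construction of spines relies on; the trees with `p` and `q` nodes are the two subtrees of a
vertex. -/
structure SpineCost (f : ℕ → ℕ) (b : ℕ) : Prop where
  zero : f 0 = 0
  mono : Monotone f
  /-- The pockets beside a band, smaller than `f n` by a constant factor, have room for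
  `f q + 1.3 * f p`. -/
  heavy_add_light : ∀ p q, p ≤ q → 10 * f q + 13 * f p ≤ 10 * f (p + q + 1)
  /-- Pockets with room for `1.3 * f n` hold the heavier subtree and two copies of the lighter one,
  so that both subtrees fit into one pocket if the lighter one does not fit into the other. -/
  heavy_add_two_light : ∀ p q, p ≤ q → 10 * f q + 20 * f p ≤ 13 * f (p + q + 1)
  /-- If the lighter subtree has at least a `b`-th part of the nodes, then putting it into a pocket
  increases the surplus `i` in `(13 + 4 * i / b) * f n ≤ 10 * room` by one. -/
  gain : ∀ p q, p ≤ q → p + q + 1 ≤ b * p →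
    13 * (b * f q) + 10 * (b * f p) + 4 * f q ≤ 13 * (b * f (p + q + 1))

/-- The spine points `X` lie above the two pockets `A` and `C` and between them, `A` on the
`σ`-left and `C` on the `σ`-right. -/
structure Pockets (σ : ℝ) (A C X : Finset (ℝ × ℝ)) : Prop where
  sign : IsSign σ
  gopA : GeneralOrthogonalPosition A
  gopC : GeneralOrthogonalPosition C
  gopX : GeneralOrthogonalPosition X
  left : ∀ a ∈ A, ∀ x ∈ X, σ * a.1 < σ * x.1
  right : ∀ c ∈ C, ∀ x ∈ X, σ * x.1 < σ * c.1
  lowA : ∀ a ∈ A, ∀ x ∈ X, a.2 < x.2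
  lowC : ∀ c ∈ C, ∀ x ∈ X, c.2 < x.2

theorem Pockets.mono {σ : ℝ} {A C X A' C' X' : Finset (ℝ × ℝ)} (h : Pockets σ A C X)
    (hA : A' ⊆ A) (hC : C' ⊆ C) (hX : X' ⊆ X) : Pockets σ A' C' X' :=
  ⟨h.sign, h.gopA.subset hA, h.gopC.subset hC, h.gopX.subset hX,
    fun a ha x hx => h.left a (hA ha) x (hX hx), fun a ha x hx => h.right a (hC ha) x (hX hx),
    fun a ha x hx => h.lowA a (hA ha) x (hX hx), fun a ha x hx => h.lowC a (hC ha) x (hX hx)⟩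

theorem Pockets.swap {σ : ℝ} {A C X : Finset (ℝ × ℝ)} (h : Pockets σ A C X) :
    Pockets (-σ) C A X :=
  ⟨h.sign.neg, h.gopC, h.gopA, h.gopX, fun a ha x hx => by have := h.right a ha x hx; linarith,
    fun a ha x hx => by have := h.left a ha x hx; linarith, h.lowC, h.lowA⟩

theorem Pockets.drawn_opposite {f : ℕ → ℕ} {N : ℕ} {σ : ℝ} {A C X : Finset (ℝ × ℝ)}
    (h : Pockets σ A C X) (hU : TopDrawable α f N) {a : α} {l r : BinaryTree α}
    (hl : l.numNodes < N) (hr : r.numNodes < N) (hA : f l.numNodes ≤ A.card)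
    (hC : f r.numNodes ≤ C.card) {v : ℝ × ℝ} (hv : v ∈ X) :
    ∃ K, TopDrawn (↑A ∪ ↑C ∪ ↑X) (.node a l r) v K ∧
      (∀ z ∈ K, z.2 = v.2 → σ * z.1 ≤ σ * v.1) ∧
      ∀ z ∈ K, σ * z.1 ≤ σ * v.1 ∨ ∃ a ∈ C, z.2 ≤ a.2 :=
  hU.drawn_opposite h.sign hl hr h.gopA h.gopC hA hC (fun a ha => h.left a ha v hv)
    (fun a ha => h.lowA a ha v hv) (fun a ha => h.right a ha v hv)
    (fun a ha => h.lowC a ha v hv) (fun _ hz => Or.inl (Or.inl hz))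
    (fun _ hz => Or.inl (Or.inr hz)) (Or.inr hv)

theorem Pockets.drawn_same {f : ℕ → ℕ} {N : ℕ} {σ : ℝ} {A C X : Finset (ℝ × ℝ)}
    (h : Pockets σ A C X) (hU : TopDrawable α f N) {a : α} {l r : BinaryTree α}
    (hl : l.numNodes < N) (hr : r.numNodes < N)
    (hA : f l.numNodes + f r.numNodes ≤ A.card) {v : ℝ × ℝ} (hv : v ∈ X) :
    ∃ K, TopDrawn (↑A ∪ ↑C ∪ ↑X) (.node a l r) v K ∧
      ∀ z ∈ K, z.2 = v.2 → σ * z.1 ≤ σ * v.1 :=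
  hU.drawn_same h.sign hl hr h.gopA hA (fun a ha => h.left a ha v hv)
    (fun a ha => h.lowA a ha v hv) (fun _ hz => Or.inl (Or.inl hz)) (Or.inr hv)

theorem Pockets.drawn_same_right {f : ℕ → ℕ} {N : ℕ} {σ : ℝ} {A C X : Finset (ℝ × ℝ)}
    (h : Pockets σ A C X) (hU : TopDrawable α f N) {a : α} {l r : BinaryTree α}
    (hl : l.numNodes < N) (hr : r.numNodes < N)
    (hC : f l.numNodes + f r.numNodes ≤ C.card) {v : ℝ × ℝ} (hv : v ∈ X) :
    ∃ K, TopDrawn (↑A ∪ ↑C ∪ ↑X) (.node a l r) v K := by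
  obtain ⟨K, hK, -⟩ := h.swap.drawn_same hU (a := a) hl hr hC hv
  exact ⟨K, by rwa [Set.union_comm (A : Set (ℝ × ℝ))]⟩

/-- A subtree is put into the part of the pocket `A` farthest from the spine; whatever is drawn
below `v` on the remaining points can be completed. -/
theorem Pockets.exists_strip {f : ℕ → ℕ} {N : ℕ} {σ : ℝ} {A C X : Finset (ℝ × ℝ)}
    (h : Pockets σ A C X) (hU : TopDrawable α f N) {l : BinaryTree α}
    (hl : l.numNodes < N) (hA : f l.numNodes ≤ A.card) {v : ℝ × ℝ} (hv : v ∈ X) :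
    ∃ A' ⊆ A, A'.card + f l.numNodes = A.card ∧
      ∀ (a : α) (r : BinaryTree α) (X' : Finset (ℝ × ℝ)) (q : ℝ × ℝ) (K : Set (ℝ × ℝ)),
        X' ⊆ X → (∀ x ∈ X', x.2 < v.2) → TopDrawn (↑A' ∪ ↑C ∪ ↑X') r q K →
        (σ * v.1 < σ * q.1 ∨ σ * q.1 < σ * v.1 ∧ ∀ z ∈ K, z.2 = q.2 → σ * z.1 ≤ σ * q.1) →
        ∃ K', TopDrawn (↑A ∪ ↑C ∪ ↑X) (.node a l r) v K' ∧
          (σ * q.1 < σ * v.1 → ∀ z ∈ K', z.2 = v.2 → σ * z.1 ≤ σ * v.1) := by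
  obtain ⟨S, hSA, hSc, hlt⟩ :=
    exists_subset_card_eq_lt (fun z => σ * z.1) (h.gopA.injOn_mul_fst h.sign) hA
  refine ⟨A \ S, sdiff_subset, by rw [card_sdiff_of_subset hSA, hSc]; omega, ?_⟩
  intro a r X' q K hX' hlow hK hq
  refine hU.drawn_strip h.sign hl (h.gopA.subset hSA) hSc.ge (fun a ha => h.left a (hSA ha) v hv)
    (fun a ha => h.lowA a (hSA ha) v hv) hK ?_ ?_ hq (fun z hz => Or.inl (Or.inl (hSA hz)))
    (Set.union_subset_union (Set.union_subset_union_left _ (coe_subset.2 sdiff_subset))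
      (coe_subset.2 hX')) (Or.inr hv)
  · rintro s hs z ((hz | hz) | hz)
    · exact hlt s hs z hz
    · exact (h.left s (hSA hs) v hv).trans (h.right z hz v hv)
    · exact h.left s (hSA hs) z (hX' hz)
  · rintro z ((hz | hz) | hz)
    · exact h.lowA z (sdiff_subset hz) v hv
    · exact h.lowC z hz v hv
    · exact hlow z hz

/-- Induction along the heavier subtrees, for properties that do not distinguish the two subtrees
of a vertex. -/
theorem heavy_induction {P : BinaryTree α → Prop}
    (swap : ∀ a l r, P (.node a l r) → P (.node a r l)) (single : ∀ a, P (.node a .nil .nil))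
    (step : ∀ a l r, l.numNodes ≤ r.numNodes → 0 < r.numNodes → P r → P (.node a l r)) :
    ∀ t, t ≠ .nil → P t := by
  have aux : ∀ a l r, l.numNodes ≤ r.numNodes → (r ≠ .nil → P r) → P (.node a l r) := by
    intro a l r hlr ih
    rcases eq_or_ne r .nil with rfl | hr
    · obtain rfl : l = .nil := by
        cases l with
        | nil => rfl
        | node _ _ _ => simp at hlr
      exact single a
    · refine step a l r hlr ?_ (ih hr)
      cases r with
      | nil => exact absurd rfl hr
      | node _ _ _ => simp
  intro t
  induction t with
  | nil => exact fun h => absurd rfl h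
  | node a l r ihl ihr =>
    intro _
    rcases le_total l.numNodes r.numNodes with hlr | hlr
    · exact aux a l r hlr ihr
    · exact swap a r l (aux a r l hlr ihl)

/-- If the pockets are larger than necessary by a factor `1.3`, the root can be put at the topmost
spine point. -/
theorem Pockets.topSafe {f : ℕ → ℕ} {N b : ℕ} (hU : TopDrawable α f N) (hf : SpineCost f b)
    {t : BinaryTree α} (ht : t ≠ .nil) (hN : t.numNodes ≤ N) {σ : ℝ}
    {A C X : Finset (ℝ × ℝ)} (h : Pockets σ A C X) (hX : t.numNodes ≤ X.card)
    (hcost : 13 * f t.numNodes ≤ 10 * (A.card + C.card)) {v : ℝ × ℝ} (hv : v ∈ X)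
    (hvX : ∀ x ∈ X, x ≠ v → x.2 < v.2) :
    ∃ K, TopDrawn (↑A ∪ ↑C ∪ ↑X) t v K := by
  refine heavy_induction (P := fun t => t.numNodes ≤ N → ∀ (σ : ℝ) (A C X : Finset (ℝ × ℝ)),
    Pockets σ A C X → t.numNodes ≤ X.card → 13 * f t.numNodes ≤ 10 * (A.card + C.card) →
    ∀ v ∈ X, (∀ x ∈ X, x ≠ v → x.2 < v.2) → ∃ K, TopDrawn (↑A ∪ ↑C ∪ ↑X) t v K)
    ?_ ?_ ?_ t ht hN σ A C X h hX hcost v hv hvX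
  · intro a l r ih hN σ A C X h hX hcost v hv hvX
    simp only [numNodes, add_comm l.numNodes] at ih hN hX hcost ⊢
    obtain ⟨K, hK⟩ := ih hN σ A C X h hX hcost v hv hvX
    exact ⟨K, hK.swap⟩
  · intro a _ σ A C X _ _ _ v hv _
    exact ⟨{v}, topDrawn_single (Or.inr hv)⟩
  intro a l r hlr hrpos ih hN σ A C X h hX hcost v hv hvX
  simp only [numNodes] at hN hX hcost
  have h1 := hf.heavy_add_light _ _ hlr
  have h2 := hf.heavy_add_two_light _ _ hlr
  by_cases hA : A.card < f l.numNodes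
  · exact h.drawn_same_right hU (by omega) (by omega) (by omega) hv
  by_cases hC : C.card < f l.numNodes
  · obtain ⟨K, hK, -⟩ := h.drawn_same hU (a := a) (l := l) (r := r) (by omega) (by omega)
      (by omega) hv
    exact ⟨K, hK⟩
  have hne : (X.erase v).Nonempty := by
    rw [← card_pos, card_erase_of_mem hv]; omega
  obtain ⟨w, hw, hwX⟩ := (h.gopX.subset (erase_subset v X)).exists_top hne
  have hwv := (mem_erase.1 hw)
  have key : ∀ {σ : ℝ} {A C : Finset (ℝ × ℝ)}, Pockets σ A C X →
      13 * f (l.numNodes + r.numNodes + 1) ≤ 10 * (A.card + C.card) →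
      f l.numNodes ≤ A.card → σ * v.1 < σ * w.1 →
      ∃ K, TopDrawn (↑A ∪ ↑C ∪ ↑X) (.node a l r) v K := by
    intro σ A C h hcost hA hlt
    obtain ⟨A', hA', hc', hstrip⟩ := h.exists_strip hU (l := l) (by omega) hA hv
    obtain ⟨K, hK⟩ := ih (by omega) _ _ _ _ (h.mono hA' Subset.rfl (erase_subset v X))
      (by rw [card_erase_of_mem hv]; omega) (by omega) w hw hwX
    obtain ⟨K', hK', -⟩ := hstrip a r _ w K (erase_subset v X)
      (fun x hx => hvX x (mem_of_mem_erase hx) (ne_of_mem_erase hx)) hK (Or.inl hlt)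
    exact ⟨K', hK'⟩
  rcases lt_or_gt_of_ne (h.gopX.injOn_mul_fst h.sign |>.ne hv hwv.2 hwv.1.symm) with hlt | hlt
  · exact key h hcost (not_lt.1 hA) hlt
  · obtain ⟨K, hK⟩ := key h.swap (by omega) (not_lt.1 hC) (by simpa using hlt)
    exact ⟨K, by rwa [Set.union_comm (A : Set (ℝ × ℝ))]⟩

/-! ### Spines along almost increasing point sets -/

/-- Every point of `H` has fewer than `n` points of `H` below it on its `σ`-right: up to these
exceptions, the points of `H` go from the lower `σ`-left to the upper `σ`-right. -/
def AlmostIncreasing (σ : ℝ) (n : ℕ) (H : Finset (ℝ × ℝ)) : Prop :=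
  ∀ v ∈ H, #{w ∈ H | w.2 < v.2 ∧ σ * v.1 < σ * w.1} < n

theorem AlmostIncreasing.mono {σ : ℝ} {n : ℕ} {H H' : Finset (ℝ × ℝ)}
    (h : AlmostIncreasing σ n H) (hH : H' ⊆ H) : AlmostIncreasing σ n H' :=
  fun v hv => (card_le_card (filter_subset_filter _ hH)).trans_lt (h v (hH hv))

/-- Almost all points of an almost increasing set lie to the lower `σ`-left of its topmost point. -/
theorem AlmostIncreasing.le_card_filter {σ : ℝ} {n : ℕ} {H : Finset (ℝ × ℝ)} (hσ : IsSign σ)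
    (hG : GeneralOrthogonalPosition H) (h : AlmostIncreasing σ n H) {J : Finset (ℝ × ℝ)}
    (hJ : J ⊆ H) {v : ℝ × ℝ} (hv : v ∈ H) (hvJ : ∀ x ∈ J, x ≠ v → x.2 < v.2) :
    J.card ≤ #{w ∈ J | σ * w.1 < σ * v.1} + n := by
  have h1 := h v hv
  have h2 : J ⊆ {w ∈ J | σ * w.1 < σ * v.1} ∪
      insert v {w ∈ H | w.2 < v.2 ∧ σ * v.1 < σ * w.1} := by
    intro w hw
    by_cases hwv : w = v
    · simp [hwv]
    · rcases lt_or_gt_of_ne (hG.injOn_mul_fst hσ |>.ne (hJ hw) hv hwv) with hlt | hlt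
      · exact mem_union_left _ (mem_filter.2 ⟨hw, hlt⟩)
      · exact mem_union_right _ (mem_insert_of_mem (mem_filter.2 ⟨hJ hw, hvJ w hw hwv, hlt⟩))
  have h3 := (card_le_card h2).trans (card_union_le _ _)
  have h4 := card_insert_le v {w ∈ H | w.2 < v.2 ∧ σ * v.1 < σ * w.1}
  omega

/-- The heavier subtree of `s` hangs in the upper part of the pocket `C`, and the lighter one is
rooted at the spine point `s'`. -/
theorem Pockets.drawn_heavy_right {f : ℕ → ℕ} {N b : ℕ} (hU : TopDrawable α f N)
    (hf : SpineCost f b) {σ : ℝ} {A C H : Finset (ℝ × ℝ)} (h : Pockets σ A C H)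
    {a : α} {l r : BinaryTree α} (hlr : l.numNodes ≤ r.numNodes)
    (hN : l.numNodes + r.numNodes + 1 ≤ N)
    (hcost : 13 * f (l.numNodes + r.numNodes + 1) ≤ 10 * (A.card + C.card))
    (hC : C.card < f (l.numNodes + r.numNodes + 1)) (hA : A.card < f l.numNodes)
    {s s' : ℝ × ℝ} (hs : s ∈ H) (hs' : s' ∈ H) (hy : s'.2 < s.2) (hx : σ * s'.1 < σ * s.1) :
    ∃ K, TopDrawn (↑A ∪ ↑C ∪ ↑H) (.node a l r) s K ∧
      ∀ z ∈ K, z.2 = s.2 → σ * z.1 ≤ σ * s.1 := by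
  have h1 := hf.heavy_add_light _ _ hlr
  have h2 := hf.heavy_add_two_light _ _ hlr
  have h3 := hf.mono hlr
  obtain ⟨Cl, hCl, hClc, hlt⟩ := exists_subset_card_eq_lt (fun z => z.2) h.gopC.injOn_snd
    (show C.card - f r.numNodes ≤ C.card by omega)
  have hCu : C \ Cl ⊆ C := sdiff_subset
  have hCuc : f r.numNodes ≤ (C \ Cl).card := by rw [card_sdiff_of_subset hCl]; omega
  obtain ⟨K₁, hb, hK₁⟩ := hU.exists_branch_side h.sign.neg (t := r) (by omega)
    (h.gopC.subset hCu) hCuc (p := s) (fun c hc => by have := h.right c (hCu hc) s hs; linarith)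
    (fun c hc => h.lowC c (hCu hc) s hs)
  obtain ⟨K, hK, hKC⟩ : ∃ K, TopDrawn (↑A ∪ ↑Cl ∪ ↑H) l s' K ∧
      ∀ z ∈ K, σ * z.1 ≤ σ * s'.1 ∨ ∃ c ∈ Cl, z.2 ≤ c.2 := by
    -- The lighter subtree of `l` needs less than `0.3 * f` of the number of all nodes, and `A` has
    -- this room because `C` provides less than `1.0` of the total of `1.3`.
    have aux : ∀ (a' : α) (l₁ l₂ : BinaryTree α), l₁.numNodes ≤ l₂.numNodes →
        l₁.numNodes + l₂.numNodes + 1 = l.numNodes →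
        ∃ K, TopDrawn (↑A ∪ ↑Cl ∪ ↑H) (.node a' l₁ l₂) s' K ∧
          ∀ z ∈ K, σ * z.1 ≤ σ * s'.1 ∨ ∃ c ∈ Cl, z.2 ≤ c.2 := by
      intro a' l₁ l₂ h12 hl
      have h4 := hf.heavy_add_light _ _ h12
      have h5 := hf.mono h12
      rw [hl] at h4
      obtain ⟨K, hK, -, hKC⟩ := (h.mono Subset.rfl hCl Subset.rfl).drawn_opposite hU (a := a')
        (l := l₁) (r := l₂) (by omega) (by omega) (by omega) (by omega) hs'
      exact ⟨K, hK, hKC⟩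
    cases l with
    | nil => simp [hf.zero] at hA
    | node a' l₁ l₂ =>
      rcases le_total l₁.numNodes l₂.numNodes with h12 | h12
      · exact aux a' l₁ l₂ h12 rfl
      · obtain ⟨K, hK, hKC⟩ := aux a' l₂ l₁ h12 (by simp only [numNodes]; omega)
        exact ⟨K, hK.swap, hKC⟩
  have hT : (↑A ∪ ↑Cl ∪ ↑H : Set (ℝ × ℝ)) ⊆ ↑A ∪ ↑C ∪ ↑H :=
    Set.union_subset_union_left _ (Set.union_subset_union_right _ (coe_subset.2 hCl))
  have hsT : s ∈ (↑A ∪ ↑C ∪ ↑H : Set (ℝ × ℝ)) := Or.inr hs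
  have hCT : ∀ c ∈ C \ Cl, c ∈ (↑A ∪ ↑C ∪ ↑H : Set (ℝ × ℝ)) := fun c hc =>
    Or.inl (Or.inr (hCu hc))
  suffices hswap : ∃ K, TopDrawn (↑A ∪ ↑C ∪ ↑H) (.node a r l) s K ∧
      ∀ z ∈ K, z.2 = s.2 → σ * z.1 ≤ σ * s.1 by
    obtain ⟨K', hK', hfree⟩ := hswap
    exact ⟨K', hK'.swap, hfree⟩
  refine hK.drawn_branch h.sign (hb.mono (S' := ↑A ∪ ↑C ∪ ↑H) hCT) ?_ ?_ hy hx ?_ hT hsT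
  · intro z hz
    rcases hK₁ z hz with hz | ⟨-, h4, -, h5, -⟩
    · exact Or.inl hz
    · exact Or.inr ⟨h5, by linarith⟩
  · intro z hz
    rcases hK₁ z hz with rfl | ⟨⟨c, hc, h4⟩, h5, ⟨d, hd, h6⟩, h7, -⟩
    · exact inBox_self hsT
    · exact (inBox_iff h.sign.neg).2
        ⟨⟨c, hCT c hc, h4⟩, ⟨s, hsT, h5⟩, ⟨d, hCT d hd, h6⟩, s, hsT, h7.le⟩
  · intro z hz hzK
    rcases hK₁ z hz with hz | ⟨-, h4, ⟨d, hd, h6⟩, -⟩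
    · exact hz
    · rcases hKC z hzK with h7 | ⟨c, hc, h7⟩
      · linarith
      · have := hlt c hc d hd
        linarith

/-- The lighter subtree of `s` hangs among the spine points, and the heavier one is rooted at a
spine point farther down. -/
theorem Pockets.drawn_light_inside {f : ℕ → ℕ} {N b n : ℕ} (hU : TopDrawable α f N)
    (hf : SpineCost f b) {σ : ℝ} {A C H : Finset (ℝ × ℝ)} (h : Pockets σ A C H)
    (hH : AlmostIncreasing σ n H) {a : α} {l r : BinaryTree α} (hlr : l.numNodes ≤ r.numNodes)
    (hr : 0 < r.numNodes) (hn : r.numNodes ≤ n) (hN : l.numNodes + r.numNodes + 1 ≤ N)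
    (hcost : 13 * f r.numNodes ≤ 10 * (A.card + C.card)) {H' : Finset (ℝ × ℝ)} (hH' : H' ⊆ H)
    (hc : f l.numNodes + 2 * n ≤ H'.card) {s : ℝ × ℝ} (hs : s ∈ H)
    (hy : ∀ x ∈ H', x.2 < s.2) (hx : ∀ x ∈ H', σ * x.1 < σ * s.1) :
    ∃ K, TopDrawn (↑A ∪ ↑C ∪ ↑H) (.node a l r) s K ∧
      ∀ z ∈ K, z.2 = s.2 → σ * z.1 ≤ σ * s.1 := by
  have hG' := h.gopX.subset hH'
  obtain ⟨D, hD, hDc, hlt⟩ := exists_subset_card_eq_lt (fun z => z.2) hG'.injOn_snd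
    (show H'.card - f l.numNodes ≤ H'.card by omega)
  have hJ : H' \ D ⊆ H' := sdiff_subset
  have hJc : f l.numNodes ≤ (H' \ D).card := by rw [card_sdiff_of_subset hD]; omega
  obtain ⟨K₁, hb, hK₁⟩ := hU.exists_branch_side h.sign (t := l) (by omega)
    (hG'.subset hJ) hJc (p := s) (fun c hc => hx c (hJ hc)) (fun c hc => hy c (hJ hc))
  -- Almost all points of `D` lie on the `σ`-left of the points reserved for the lighter subtree.
  obtain ⟨X, hXD, hXc, hX⟩ : ∃ X ⊆ D, n ≤ X.card ∧ ∀ x ∈ X, ∀ y ∈ H' \ D, σ * x.1 < σ * y.1 := by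
    rcases (H' \ D).eq_empty_or_nonempty with he | hne
    · exact ⟨D, Subset.rfl, by omega, by simp [he]⟩
    · obtain ⟨y, hyJ, hmin⟩ := exists_min_image (H' \ D) (fun z => σ * z.1) hne
      have h1 := hH.le_card_filter h.sign h.gopX (hD.trans hH') (hH' (hJ hyJ))
        (fun x hx _ => hlt x hx y hyJ)
      exact ⟨{w ∈ D | σ * w.1 < σ * y.1}, filter_subset _ _, by omega,
        fun x hx z hz => (mem_filter.1 hx).2.trans_le (hmin z hz)⟩
  have hXH := (hXD.trans hD).trans hH'
  obtain ⟨x, hxX, hxtop⟩ := (h.gopX.subset hXH).exists_top (card_pos.1 (by omega))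
  obtain ⟨K, hK⟩ := (h.mono Subset.rfl Subset.rfl hXH).topSafe hU hf (t := r)
    (by rintro rfl; simp at hr) (by omega) (by omega) hcost hxX hxtop
  have hT : (↑A ∪ ↑C ∪ ↑X : Set (ℝ × ℝ)) ⊆ ↑A ∪ ↑C ∪ ↑H :=
    Set.union_subset_union_right _ (coe_subset.2 hXH)
  have hsT : s ∈ (↑A ∪ ↑C ∪ ↑H : Set (ℝ × ℝ)) := Or.inr hs
  have hJT : ∀ c ∈ H' \ D, c ∈ (↑A ∪ ↑C ∪ ↑H : Set (ℝ × ℝ)) := fun c hc =>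
    Or.inr (hH' (hJ hc))
  have hxH' := hD (hXD hxX)
  refine hK.drawn_branch h.sign (a := a) (hb.mono (S' := ↑A ∪ ↑C ∪ ↑H) hJT) ?_ ?_
    (hy x hxH') (hx x hxH') ?_ hT hsT
  · intro z hz
    rcases hK₁ z hz with hz | ⟨⟨c, hc, h4⟩, -, -, h5, -⟩
    · exact Or.inl hz
    · exact Or.inr ⟨h5, (hX x hxX c hc).trans_le h4⟩
  · intro z hz
    rcases hK₁ z hz with rfl | ⟨⟨c, hc, h4⟩, h5, ⟨d, hd, h6⟩, h7, -⟩
    · exact inBox_self hsT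
    · exact (inBox_iff h.sign).2
        ⟨⟨c, hJT c hc, h4⟩, ⟨s, hsT, h5⟩, ⟨d, hJT d hd, h6⟩, s, hsT, h7.le⟩
  · intro z hz hzK
    rcases hK₁ z hz with hz | ⟨-, -, ⟨d, hd, h6⟩, -⟩
    · exact hz
    · have h7 := hK.le z hzK
      have := hlt x (hXD hxX) d hd
      linarith

/-- A spine along an almost increasing set `H`, with the `σ`-right ray at its root free. The
surplus of the pockets, measured by `i`, grows whenever a subtree with at least a `b`-th part of the
nodes is put into the pocket `A`, and it stays below `2 * b` as each pocket is smaller than `f` of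
the number of nodes; thus at most `j` such steps remain, and each of them uses up at most `n`
points of `H`. -/
theorem Pockets.rightFree {f : ℕ → ℕ} {N b n : ℕ} (hU : TopDrawable α f N) (hf : SpineCost f b)
    (hb : 0 < b) (hnN : n ≤ N) {t : BinaryTree α} (ht : t ≠ .nil) (hn : t.numNodes ≤ n) {i j : ℕ}
    (hij : i + j = 2 * b) {σ : ℝ} {A C H : Finset (ℝ × ℝ)} (h : Pockets σ A C H)
    (hH : AlmostIncreasing σ n H) (hA : A.card < f t.numNodes) (hC : C.card < f t.numNodes)
    (hcost : (13 * b + 4 * i) * f t.numNodes ≤ 10 * b * (A.card + C.card))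
    (hc : (j + 3) * n + f (n / b) ≤ H.card) {s : ℝ × ℝ} (hs : s ∈ H)
    (hsH : ∀ x ∈ H, x ≠ s → x.2 < s.2) :
    ∃ K, TopDrawn (↑A ∪ ↑C ∪ ↑H) t s K ∧ ∀ z ∈ K, z.2 = s.2 → σ * z.1 ≤ σ * s.1 := by
  refine heavy_induction (P := fun t => t.numNodes ≤ n → ∀ (i j : ℕ), i + j = 2 * b →
    ∀ A H : Finset (ℝ × ℝ), Pockets σ A C H → AlmostIncreasing σ n H →
    A.card < f t.numNodes → C.card < f t.numNodes →
    (13 * b + 4 * i) * f t.numNodes ≤ 10 * b * (A.card + C.card) →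
    (j + 3) * n + f (n / b) ≤ H.card → ∀ s ∈ H, (∀ x ∈ H, x ≠ s → x.2 < s.2) →
    ∃ K, TopDrawn (↑A ∪ ↑C ∪ ↑H) t s K ∧ ∀ z ∈ K, z.2 = s.2 → σ * z.1 ≤ σ * s.1)
    ?_ ?_ ?_ t ht hn i j hij A H h hH hA hC hcost hc s hs hsH
  · intro a l r ih hn i j hij A H h hH hA hC hcost hc s hs hsH
    simp only [numNodes, add_comm l.numNodes] at ih hn hA hC hcost ⊢
    obtain ⟨K, hK, hfree⟩ := ih hn i j hij A H h hH hA hC hcost hc s hs hsH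
    exact ⟨K, hK.swap, hfree⟩
  · intro a _ i j _ A H _ _ _ _ _ _ s hs _
    exact ⟨{s}, topDrawn_single (Or.inr hs), fun z hz _ => by rw [show z = s from hz]⟩
  intro a l r hlr hr ih hn i j hij A H h hH hA hC hcost hc s hs hsH
  simp only [numNodes] at hn hA hC hcost
  have h1 := hf.heavy_add_light _ _ hlr
  have h2 := hf.heavy_add_two_light _ _ hlr
  have h3 := hf.mono hlr
  have h4 : f r.numNodes ≤ f (l.numNodes + r.numNodes + 1) := hf.mono (by omega)
  have hcost' : 13 * f (l.numNodes + r.numNodes + 1) ≤ 10 * (A.card + C.card) := by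
    refine Nat.le_of_mul_le_mul_left ?_ hb
    nlinarith
  -- For `i = 2 * b` the pockets together would exceed twice their upper bound.
  have hj : 0 < j := by
    rcases Nat.eq_zero_or_pos j with rfl | hj
    · obtain rfl : i = 2 * b := by omega
      have : 10 * b * (A.card + C.card) < 10 * b * (2 * f (l.numNodes + r.numNodes + 1)) :=
        Nat.mul_lt_mul_of_pos_left (by omega) (by omega)
      nlinarith
    · exact hj
  obtain ⟨j, rfl⟩ : ∃ k, j = k + 1 := ⟨j - 1, by omega⟩
  set H' := {w ∈ H | σ * w.1 < σ * s.1} with hH'def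
  have hH' : H' ⊆ H := filter_subset _ _
  have hH'c : H.card ≤ H'.card + n := hH.le_card_filter h.sign h.gopX Subset.rfl hs hsH
  have hxs : ∀ x ∈ H', σ * x.1 < σ * s.1 := fun x hx => (mem_filter.1 hx).2
  have hys : ∀ x ∈ H', x.2 < s.2 := fun x hx => hsH x (hH' hx) fun e => by
    have := hxs x hx
    rw [e] at this
    exact lt_irrefl _ this
  have hexp : (j + 1 + 3) * n = (j + 3) * n + n := by ring
  have hexp' : (j + 3) * n = j * n + 3 * n := by ring
  obtain ⟨s', hs', hsH'⟩ := (h.gopX.subset hH').exists_top (card_pos.1 (by omega))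
  by_cases hopp : f l.numNodes ≤ A.card ∧ f r.numNodes ≤ C.card
  · obtain ⟨K, hK, hfree, -⟩ := h.drawn_opposite hU (a := a) (l := l) (r := r) (by omega)
      (by omega) hopp.1 hopp.2 hs
    exact ⟨K, hK, hfree⟩
  by_cases hopp' : f r.numNodes ≤ A.card ∧ f l.numNodes ≤ C.card
  · obtain ⟨K, hK, hfree, -⟩ := h.drawn_opposite hU (a := a) (l := r) (r := l) (by omega)
      (by omega) hopp'.1 hopp'.2 hs
    exact ⟨K, hK.swap, hfree⟩
  by_cases hsame : f l.numNodes + f r.numNodes ≤ A.card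
  · exact h.drawn_same hU (by omega) (by omega) hsame hs
  by_cases hAl : A.card < f l.numNodes
  · exact h.drawn_heavy_right hU hf hlr (by omega) hcost' hC hAl hs (hH' hs') (hys s' hs')
      (hxs s' hs')
  by_cases hbal : l.numNodes + r.numNodes + 1 ≤ b * l.numNodes
  · obtain ⟨A', hA', hc', hstrip⟩ := h.exists_strip hU (l := l) (by omega) (not_lt.1 hAl) hs
    have hgain := hf.gain _ _ hlr hbal
    obtain ⟨K, hK, hfree⟩ := ih (by omega) (i + 1) j (by omega) A' H'
      (h.mono hA' Subset.rfl hH') (hH.mono hH') (by omega) (by omega) (by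
        have e1 : 10 * b * (A.card + C.card) =
            10 * b * (A'.card + C.card) + 10 * (b * f l.numNodes) := by rw [← hc']; ring
        have e2 := Nat.mul_le_mul_left (4 * i) h4
        nlinarith) (by omega) s' hs' hsH'
    obtain ⟨K', hK', hfree'⟩ := hstrip a r H' s' K hH' hys hK (Or.inr ⟨hxs s' hs', hfree⟩)
    exact ⟨K', hK', hfree' (hxs s' hs')⟩
  · have hlm : f l.numNodes ≤ f (n / b) := hf.mono ((Nat.le_div_iff_mul_le hb).2 (by
      rw [mul_comm]; omega))
    exact h.drawn_light_inside hU hf hH hlr hr (by omega) (by omega) (by omega) hH' (by omega)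
      hs hys hxs

/-! ### Spines along two groups of points -/

/-- The number of nodes of the lighter one of the two subtrees at the root. -/
def lightNodes : BinaryTree α → ℕ
  | .nil => 0
  | .node _ l r => min l.numNodes r.numNodes

/-- The number of nodes of the heavier one of the two subtrees at the root. -/
def heavyNodes : BinaryTree α → ℕ
  | .nil => 0
  | .node _ l r => max l.numNodes r.numNodes

/-- If the pocket `C` is too small for the lighter subtree, the root can be put at some point of a
large set `H`. -/
theorem Pockets.drawn_small_right {f : ℕ → ℕ} {N b n : ℕ} (hU : TopDrawable α f N)
    (hf : SpineCost f b) (hb : 0 < b) (hnN : n ≤ N) {t : BinaryTree α} (hn : t.numNodes ≤ n)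
    {σ : ℝ} {A C H : Finset (ℝ × ℝ)} (h : Pockets σ A C H)
    (hcost : 10 * f (heavyNodes t) + 13 * f (lightNodes t) ≤ 10 * (A.card + C.card))
    (hC : C.card < f (lightNodes t)) (hc : (2 * b + 4) * n + f (n / b) ≤ H.card) :
    ∃ s ∈ H, ∃ K, TopDrawn (↑A ∪ ↑C ∪ ↑H) t s K := by
  have aux : ∀ (a : α) (l r : BinaryTree α), l.numNodes ≤ r.numNodes →
      l.numNodes + r.numNodes + 1 ≤ n →
      10 * f r.numNodes + 13 * f l.numNodes ≤ 10 * (A.card + C.card) →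
      C.card < f l.numNodes → ∃ s ∈ H, ∃ K, TopDrawn (↑A ∪ ↑C ∪ ↑H) (.node a l r) s K := by
    intro a l r hlr hn hcost hC
    have hexp : (2 * b + 4) * n = (2 * b + 3) * n + n := by ring
    have hl : l ≠ .nil := by rintro rfl; simp [hf.zero] at hC
    obtain ⟨s, hs, hsH⟩ := h.gopX.exists_top (card_pos.1 (by omega))
    by_cases hsame : f l.numNodes + f r.numNodes ≤ A.card
    · obtain ⟨K, hK, -⟩ := h.drawn_same hU (a := a) (by omega) (by omega) hsame hs
      exact ⟨s, hs, K, hK⟩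
    -- From here on the heavier subtree goes into `A`, which leaves room for `1.3 * f` of the size
    -- of the lighter one.
    by_cases hex : ∃ v ∈ H, n ≤ #{w ∈ H | w.2 < v.2 ∧ σ * v.1 < σ * w.1}
    · obtain ⟨v, hv, hvn⟩ := hex
      set W := {w ∈ H | w.2 < v.2 ∧ σ * v.1 < σ * w.1} with hW
      have hWH : W ⊆ H := filter_subset _ _
      obtain ⟨x, hx, hxW⟩ := (h.gopX.subset hWH).exists_top (card_pos.1 (by omega))
      obtain ⟨A', hA', hc', hstrip⟩ := h.exists_strip hU (l := r) (by omega) (by omega) hv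
      obtain ⟨K, hK⟩ := (h.mono hA' Subset.rfl hWH).topSafe hU hf hl (by omega) (by omega)
        (by omega) hx hxW
      obtain ⟨K', hK', -⟩ := hstrip a l W x K hWH (fun w hw => (mem_filter.1 hw).2.1) hK
        (Or.inl (mem_filter.1 hx).2.2)
      exact ⟨v, hv, K', hK'.swap⟩
    · have hH : AlmostIncreasing σ n H := fun v hv => by
        by_contra hvn
        exact hex ⟨v, hv, not_lt.1 hvn⟩
      set H' := {w ∈ H | σ * w.1 < σ * s.1} with hH'def
      have hH' : H' ⊆ H := filter_subset _ _
      have hH'c : H.card ≤ H'.card + n := hH.le_card_filter h.sign h.gopX Subset.rfl hs hsH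
      have hxs : ∀ x ∈ H', σ * x.1 < σ * s.1 := fun x hx => (mem_filter.1 hx).2
      have hys : ∀ x ∈ H', x.2 < s.2 := fun x hx => hsH x (hH' hx) fun e => by
        have := hxs x hx
        rw [e] at this
        exact lt_irrefl _ this
      have hexp' : (2 * b + 3) * n = 2 * b * n + 3 * n := by ring
      obtain ⟨s', hs', hsH'⟩ := (h.gopX.subset hH').exists_top (card_pos.1 (by omega))
      obtain ⟨A', hA', hc', hstrip⟩ := h.exists_strip hU (l := r) (by omega) (by omega) hs
      obtain ⟨K, hK, hfree⟩ := (h.mono hA' Subset.rfl hH').rightFree hU hf hb hnN hl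
        (by omega) (i := 0) (j := 2 * b) (by omega) (hH.mono hH') (by omega) hC (by
          rw [mul_zero, add_zero, mul_comm 13, mul_comm 10, mul_assoc, mul_assoc]
          exact Nat.mul_le_mul_left b (by omega)) (by omega) hs' hsH'
      obtain ⟨K', hK', -⟩ := hstrip a l H' s' K hH' hys hK (Or.inr ⟨hxs s' hs', hfree⟩)
      exact ⟨s, hs, K', hK'.swap⟩
  cases t with
  | nil => simp [lightNodes, hf.zero] at hC
  | node a l r =>
    simp only [lightNodes, heavyNodes, numNodes] at hn hcost hC
    rcases le_total l.numNodes r.numNodes with hlr | hlr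
    · rw [min_eq_left hlr] at hC hcost
      rw [max_eq_right hlr] at hcost
      exact aux a l r hlr hn hcost hC
    · rw [min_eq_right hlr] at hC hcost
      rw [max_eq_left hlr] at hcost
      obtain ⟨s, hs, K, hK⟩ := aux a r l hlr (by omega) hcost hC
      exact ⟨s, hs, K, hK.swap⟩

theorem SpineCost.heavyNodes_add_lightNodes {f : ℕ → ℕ} {b : ℕ} (hf : SpineCost f b)
    (t : BinaryTree α) :
    10 * f (heavyNodes t) + 13 * f (lightNodes t) ≤ 10 * f t.numNodes := by
  cases t with
  | nil => simp [heavyNodes, lightNodes, hf.zero]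
  | node a l r =>
    simp only [heavyNodes, lightNodes, numNodes]
    rcases le_total l.numNodes r.numNodes with hlr | hlr
    · rw [max_eq_right hlr, min_eq_left hlr]
      exact hf.heavy_add_light _ _ hlr
    · rw [max_eq_left hlr, min_eq_right hlr, add_comm l.numNodes]
      exact hf.heavy_add_light _ _ hlr

/-- The root can be put at the topmost point of `X` if the lighter subtree fits into the pocket
`C`, or both subtrees fit into the pocket `A`. The spine continues through `X`; at the moment when
this condition is about to fail it moves into `H`. -/
theorem Pockets.drawn_top {f : ℕ → ℕ} {N b n : ℕ} (hU : TopDrawable α f N) (hf : SpineCost f b)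
    (hb : 0 < b) (hnN : n ≤ N) {t : BinaryTree α} (ht : t ≠ .nil) (hn : t.numNodes ≤ n)
    {σ : ℝ} {A C X H : Finset (ℝ × ℝ)} (h : Pockets σ A C (X ∪ H))
    (hHy : ∀ w ∈ H, ∀ x ∈ X, w.2 < x.2) (hHx : ∀ w ∈ H, ∀ x ∈ X, σ * w.1 < σ * x.1)
    (hcost : 10 * f (heavyNodes t) + 13 * f (lightNodes t) ≤ 10 * (A.card + C.card))
    (hfit : f (lightNodes t) ≤ C.card ∨ f (lightNodes t) + f (heavyNodes t) ≤ A.card)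
    (hX : t.numNodes ≤ X.card) (hH : (2 * b + 4) * n + f (n / b) ≤ H.card)
    {v : ℝ × ℝ} (hv : v ∈ X) (hvX : ∀ x ∈ X, x ≠ v → x.2 < v.2) :
    ∃ K, TopDrawn (↑A ∪ ↑C ∪ ↑(X ∪ H)) t v K := by
  refine heavy_induction (P := fun t => t.numNodes ≤ n → ∀ A C X : Finset (ℝ × ℝ),
    Pockets σ A C (X ∪ H) → (∀ w ∈ H, ∀ x ∈ X, w.2 < x.2) →
    (∀ w ∈ H, ∀ x ∈ X, σ * w.1 < σ * x.1) →
    10 * f (heavyNodes t) + 13 * f (lightNodes t) ≤ 10 * (A.card + C.card) →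
    (f (lightNodes t) ≤ C.card ∨ f (lightNodes t) + f (heavyNodes t) ≤ A.card) →
    t.numNodes ≤ X.card → ∀ v ∈ X, (∀ x ∈ X, x ≠ v → x.2 < v.2) →
    ∃ K, TopDrawn (↑A ∪ ↑C ∪ ↑(X ∪ H)) t v K)
    ?_ ?_ ?_ t ht hn A C X h hHy hHx hcost hfit hX v hv hvX
  · intro a l r ih hn A C X h hHy hHx hcost hfit hX v hv hvX
    simp only [numNodes, lightNodes, heavyNodes, add_comm l.numNodes, min_comm l.numNodes,
      max_comm l.numNodes] at ih hn hX hcost hfit ⊢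
    obtain ⟨K, hK⟩ := ih hn A C X h hHy hHx hcost hfit hX v hv hvX
    exact ⟨K, hK.swap⟩
  · intro a _ A C X _ _ _ _ _ _ v hv _
    exact ⟨{v}, topDrawn_single (Or.inr (mem_coe.2 (mem_union_left _ hv)))⟩
  intro a l r hlr hrpos ih hn A C X h hHy hHx hcost hfit hX v hv hvX
  simp only [numNodes, lightNodes, heavyNodes, min_eq_left hlr, max_eq_right hlr]
    at hn hX hcost hfit
  have hvU : v ∈ X ∪ H := mem_union_left _ hv
  have hHU : H ⊆ X ∪ H := subset_union_right
  have hr : r ≠ .nil := by rintro rfl; simp at hrpos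
  have hHpos : n ≤ H.card := by
    have : (2 * b + 4) * n = (2 * b + 3) * n + n := by ring
    omega
  by_cases hsame : f l.numNodes + f r.numNodes ≤ A.card
  · obtain ⟨K, hK, -⟩ := h.drawn_same hU (a := a) (by omega) (by omega) hsame hvU
    exact ⟨K, hK⟩
  by_cases hopp : f l.numNodes ≤ A.card ∧ f r.numNodes ≤ C.card
  · obtain ⟨K, hK, -, -⟩ := h.drawn_opposite hU (a := a) (l := l) (r := r) (by omega)
      (by omega) hopp.1 hopp.2 hvU
    exact ⟨K, hK⟩
  have hlC : f l.numNodes ≤ C.card := by omega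
  by_cases hopp' : f r.numNodes ≤ A.card
  · obtain ⟨K, hK, -, -⟩ := h.drawn_opposite hU (a := a) (l := r) (r := l) (by omega)
      (by omega) hopp' hlC hvU
    exact ⟨K, hK.swap⟩
  have hHv : ∀ w ∈ H, w.2 < v.2 := fun w hw => hHy w hw v hv
  by_cases hAl : A.card < f l.numNodes
  -- The heavier subtree goes into `C`, and the spine leaves `X` with the lighter one.
  · have hl : l ≠ .nil := by rintro rfl; simp [hf.zero] at hAl
    obtain ⟨C', hC', hc', hstrip⟩ := h.swap.exists_strip hU (l := r) (by omega) (by omega) hvU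
    obtain ⟨w, hw, hwH⟩ := (h.gopX.subset hHU).exists_top (card_pos.1 (by omega))
    obtain ⟨K, hK⟩ := (h.swap.mono hC' Subset.rfl hHU).topSafe hU hf hl (by omega) (by omega)
      (by omega) hw hwH
    obtain ⟨K', hK', -⟩ := hstrip a l H w K hHU hHv hK
      (Or.inl (by have := hHx w hw v hv; linarith))
    rw [Set.union_comm (C : Set (ℝ × ℝ))] at hK'
    exact ⟨K', hK'.swap⟩
  have hcost_r := hf.heavyNodes_add_lightNodes r
  have hne : (X.erase v).Nonempty := by
    rw [← card_pos, card_erase_of_mem hv]; omega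
  have hXX : X.erase v ⊆ X := erase_subset v X
  have hXU : X.erase v ∪ H ⊆ X ∪ H := union_subset_union_left hXX
  have hXlow : ∀ x ∈ X.erase v ∪ H, x.2 < v.2 := fun x hx => by
    rcases mem_union.1 hx with hx | hx
    · exact hvX x (hXX hx) (ne_of_mem_erase hx)
    · exact hHv x hx
  have hXc : r.numNodes ≤ (X.erase v).card := by rw [card_erase_of_mem hv]; omega
  obtain ⟨w, hw, hwX⟩ := (h.gopX.subset (hXX.trans subset_union_left)).exists_top hne
  have hwv := mem_erase.1 hw
  by_cases hsmall : C.card < f l.numNodes + f (lightNodes r)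
  -- The lighter subtree goes into `C`, which becomes too small for the next lighter subtree.
  · obtain ⟨C', hC', hc', hstrip⟩ := h.swap.exists_strip hU (l := l) (by omega) hlC hvU
    obtain ⟨s, hs, K, hK⟩ := (h.mono Subset.rfl hC' hHU).drawn_small_right hU hf hb hnN (t := r)
      (by omega) (by omega) (by omega) hH
    rw [Set.union_comm (A : Set (ℝ × ℝ))] at hK
    obtain ⟨K', hK', -⟩ := hstrip a r H s K hHU hHv hK
      (Or.inl (by have := hHx s hs v hv; linarith))
    rw [Set.union_comm (C : Set (ℝ × ℝ))] at hK'
    exact ⟨K', hK'⟩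
  rcases lt_or_gt_of_ne (h.gopX.injOn_mul_fst h.sign |>.ne (mem_coe.2 hvU)
    (mem_coe.2 (mem_union_left _ hwv.2)) hwv.1.symm) with hlt | hlt
  · obtain ⟨A', hA', hc', hstrip⟩ := h.exists_strip hU (l := l) (by omega) (not_lt.1 hAl) hvU
    obtain ⟨K, hK⟩ := ih (by omega) A' C _ (h.mono hA' Subset.rfl hXU)
      (fun w hw x hx => hHy w hw x (hXX hx)) (fun w hw x hx => hHx w hw x (hXX hx))
      (by omega) (by omega) hXc w hw hwX
    obtain ⟨K', hK', -⟩ := hstrip a r _ w K hXU hXlow hK (Or.inl hlt)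
    exact ⟨K', hK'⟩
  · obtain ⟨C', hC', hc', hstrip⟩ := h.swap.exists_strip hU (l := l) (by omega) hlC hvU
    obtain ⟨K, hK⟩ := ih (by omega) A C' _ (h.mono Subset.rfl hC' hXU)
      (fun w hw x hx => hHy w hw x (hXX hx)) (fun w hw x hx => hHx w hw x (hXX hx))
      (by omega) (by omega) hXc w hw hwX
    rw [Set.union_comm (A : Set (ℝ × ℝ))] at hK
    obtain ⟨K', hK', -⟩ := hstrip a r _ w K hXU hXlow hK (Or.inl (by simpa using hlt))
    rw [Set.union_comm (C : Set (ℝ × ℝ))] at hK'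
    exact ⟨K', hK'⟩

/-! ### The pockets beside a band of points -/

/-- The number of points in the group of points that carries the spine: `2 * n` points at the top,
and below them twice as many as `Pockets.drawn_small_right` asks for. -/
def bandSize (f : ℕ → ℕ) (b n : ℕ) : ℕ := 2 * n + 2 * ((2 * b + 4) * n + f (n / b))

/-- Among `M + 1` groups of `h` points of `W`, consecutive in the direction of the `x`-axis, there
is one whose `x`-range contains at most one `M + 1`-st of the points of `E`. -/
theorem exists_group (M h : ℕ) {W : Finset (ℝ × ℝ)} (hW : Set.InjOn (fun z : ℝ × ℝ => z.1) W)
    (E : Finset (ℝ × ℝ)) (hM : (M + 1) * h ≤ W.card) :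
    ∃ B ⊆ W, B.card = h ∧
      (M + 1) * #{e ∈ E | ¬(∀ b ∈ B, e.1 < b.1) ∧ ¬∀ b ∈ B, b.1 < e.1} ≤ E.card := by
  induction M generalizing W E with
  | zero =>
    obtain ⟨B, hB, hBc⟩ := exists_subset_card_eq (show h ≤ W.card by omega)
    exact ⟨B, hB, hBc, by simpa using card_filter_le _ _⟩
  | succ M ih =>
    have hexp : (M + 1 + 1) * h = (M + 1) * h + h := by ring
    obtain ⟨B₁, hB₁, hB₁c, hlt⟩ := exists_subset_card_eq_lt (fun z => z.1) hW
      (show h ≤ W.card by omega)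
    set E₁ := {e ∈ E | ¬(∀ b ∈ B₁, e.1 < b.1) ∧ ¬∀ b ∈ B₁, b.1 < e.1} with hE₁
    by_cases hfew : (M + 1 + 1) * E₁.card ≤ E.card
    · exact ⟨B₁, hB₁, hB₁c, hfew⟩
    have hE₁E : E₁ ⊆ E := filter_subset _ _
    obtain ⟨B, hB, hBc, hBE⟩ := ih (W := W \ B₁) (hW.mono (coe_subset.2 sdiff_subset)) (E \ E₁)
      (by rw [card_sdiff_of_subset hB₁]; omega)
    refine ⟨B, hB.trans sdiff_subset, hBc, ?_⟩
    have hsub : {e ∈ E | ¬(∀ b ∈ B, e.1 < b.1) ∧ ¬∀ b ∈ B, b.1 < e.1} ⊆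
        {e ∈ E \ E₁ | ¬(∀ b ∈ B, e.1 < b.1) ∧ ¬∀ b ∈ B, b.1 < e.1} := by
      intro e he
      obtain ⟨he, heB, heB'⟩ := mem_filter.1 he
      refine mem_filter.2 ⟨mem_sdiff.2 ⟨he, fun he₁ => heB fun b hb => ?_⟩, heB, heB'⟩
      obtain ⟨-, -, h₂⟩ := mem_filter.1 he₁
      push Not at h₂
      obtain ⟨b₁, hb₁, h₂⟩ := h₂
      exact h₂.trans_lt (hlt b₁ hb₁ b (hB hb))
    have h1 := card_le_card hsub
    rw [card_sdiff_of_subset hE₁E] at hBE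
    have h2 := card_le_card hE₁E
    have h3 := Nat.mul_le_mul_left (M + 1) h1
    obtain ⟨d, hd⟩ := Nat.exists_eq_add_of_le h2
    rw [hd, Nat.add_sub_cancel_left] at hBE
    have h4 : d < (M + 1) * E₁.card := by
      have h5 := not_le.1 hfew
      rw [hd] at h5
      linarith
    refine Nat.le_of_mul_le_mul_left ?_ (Nat.succ_pos M)
    rw [hd]
    nlinarith

/-- A group `B` of consecutive points of the highest `(M + 1) * h` points, with the pockets to the
left and to the right of it. -/
theorem exists_pockets (M h : ℕ) {P : Finset (ℝ × ℝ)}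
    (hP : GeneralOrthogonalPosition P) (hM : (M + 1) * h ≤ P.card) :
    ∃ A ⊆ P, ∃ C ⊆ P, ∃ B ⊆ P, Pockets 1 A C B ∧ B.card = h ∧
      M * P.card ≤ (M + 1) * (A.card + C.card) + (M + 1) * (M + 1) * h := by
  obtain ⟨E, hE, hEc, hlt⟩ := exists_subset_card_eq_lt (fun z => z.2) hP.injOn_snd
    (show P.card - (M + 1) * h ≤ P.card by omega)
  have hW : P \ E ⊆ P := sdiff_subset
  have hinj : Set.InjOn (fun z : ℝ × ℝ => z.1) (P : Set (ℝ × ℝ)) := by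
    simpa using hP.injOn_mul_fst (σ := 1) (Or.inl rfl)
  obtain ⟨B, hB, hBc, hBE⟩ := exists_group M h (hinj.mono (coe_subset.2 hW)) E
    (by rw [card_sdiff_of_subset hE]; omega)
  refine ⟨{e ∈ E | ∀ b ∈ B, e.1 < b.1}, (filter_subset _ _).trans hE,
    {e ∈ E | ∀ b ∈ B, b.1 < e.1}, (filter_subset _ _).trans hE, B, hB.trans hW,
    ⟨Or.inl rfl, hP.subset ((filter_subset _ _).trans hE),
      hP.subset ((filter_subset _ _).trans hE), hP.subset (hB.trans hW), ?_, ?_, ?_, ?_⟩, hBc, ?_⟩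
  · intro a ha x hx
    simpa using (mem_filter.1 ha).2 x hx
  · intro a ha x hx
    simpa using (mem_filter.1 ha).2 x hx
  · exact fun a ha x hx => hlt a (mem_filter.1 ha).1 x (hB hx)
  · exact fun a ha x hx => hlt a (mem_filter.1 ha).1 x (hB hx)
  · have hcov : E ⊆ ({e ∈ E | ∀ b ∈ B, e.1 < b.1} ∪ {e ∈ E | ∀ b ∈ B, b.1 < e.1}) ∪
        {e ∈ E | ¬(∀ b ∈ B, e.1 < b.1) ∧ ¬∀ b ∈ B, b.1 < e.1} := by
      intro e he
      simp only [mem_union, mem_filter]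
      tauto
    have h1 := (card_le_card hcov).trans (card_union_le _ _)
    have h2 := card_union_le {e ∈ E | ∀ b ∈ B, e.1 < b.1} {e ∈ E | ∀ b ∈ B, b.1 < e.1}
    have h3 := Nat.mul_le_mul_left (M + 1) (h1.trans (Nat.add_le_add_right h2 _))
    have h4 : P.card = E.card + (M + 1) * h := by omega
    rw [h4]
    nlinarith

/-- The spine starts in `X` if the pocket `C` has room for the lighter subtree, and in `H`
otherwise. -/
theorem Pockets.exists_topDrawn {f : ℕ → ℕ} {b : ℕ} {t : BinaryTree α}
    (hU : TopDrawable α f t.numNodes) (hf : SpineCost f b) (hb : 0 < b) (ht : t ≠ .nil)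
    {σ : ℝ} {A C X H : Finset (ℝ × ℝ)} (h : Pockets σ A C (X ∪ H))
    (hHy : ∀ w ∈ H, ∀ x ∈ X, w.2 < x.2) (hHx : ∀ w ∈ H, ∀ x ∈ X, σ * w.1 < σ * x.1)
    (hcost : 10 * f (heavyNodes t) + 13 * f (lightNodes t) ≤ 10 * (A.card + C.card))
    (hX : t.numNodes ≤ X.card)
    (hH : (2 * b + 4) * t.numNodes + f (t.numNodes / b) ≤ H.card) :
    ∃ s K, TopDrawn (↑A ∪ ↑C ∪ ↑(X ∪ H)) t s K := by
  have hpos : 0 < t.numNodes := by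
    cases t with
    | nil => exact absurd rfl ht
    | node _ _ _ => simp
  by_cases hC : C.card < f (lightNodes t)
  · obtain ⟨s, hs, K, hK⟩ := (h.mono Subset.rfl Subset.rfl subset_union_right).drawn_small_right
      hU hf hb le_rfl le_rfl hcost hC hH
    exact ⟨s, K, hK.mono (Set.union_subset_union_right _ (coe_subset.2 subset_union_right))⟩
  · obtain ⟨v, hv, hvX⟩ := (h.gopX.subset subset_union_left).exists_top
      (card_pos.1 (hpos.trans_le hX))
    obtain ⟨K, hK⟩ := h.drawn_top hU hf hb le_rfl ht le_rfl hHy hHx hcost (Or.inl (not_lt.1 hC))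
      hX hH hv hvX
    exact ⟨v, K, hK⟩

/-- A tree whose subtrees fit into the pockets beside some band can be drawn. -/
theorem TopDrawable.drawn_band {f : ℕ → ℕ} {b M : ℕ} {t : BinaryTree α}
    (hU : TopDrawable α f t.numNodes) (hf : SpineCost f b) (hb : 0 < b) (ht : t ≠ .nil)
    {P : Finset (ℝ × ℝ)} (hP : GeneralOrthogonalPosition P)
    (hM : (M + 1) * bandSize f b t.numNodes ≤ P.card)
    (hcost : (M + 1) * (10 * f (heavyNodes t) + 13 * f (lightNodes t)) +
      10 * ((M + 1) * (M + 1) * bandSize f b t.numNodes) ≤ 10 * M * P.card) :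
    ∃ s K, TopDrawn P t s K := by
  have hpos : 0 < t.numNodes := by
    cases t with
    | nil => exact absurd rfl ht
    | node _ _ _ => simp
  set n := t.numNodes with hn
  set k := (2 * b + 4) * n + f (n / b) with hk
  have hh : bandSize f b n = 2 * n + 2 * k := rfl
  obtain ⟨A, hA, C, hC, B, hB, h, hBc, hAC⟩ := exists_pockets M (bandSize f b n) hP hM
  have hcost' : 10 * f (heavyNodes t) + 13 * f (lightNodes t) ≤ 10 * (A.card + C.card) := by
    refine Nat.le_of_mul_le_mul_left ?_ (Nat.succ_pos M)
    nlinarith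
  -- The top `2 * n` points of the group are split into a left and a right half; each of the
  -- other points is on the left of the right half or on the right of the left half.
  obtain ⟨D, hD, hDc, hlt⟩ := exists_subset_card_eq_lt (fun z => z.2) h.gopX.injOn_snd
    (show 2 * k ≤ B.card by omega)
  have hUB : B \ D ⊆ B := sdiff_subset
  obtain ⟨X₁, hX₁, hX₁c, hlt'⟩ := exists_subset_card_eq_lt (m := n) (fun z => 1 * z.1)
    ((h.gopX.injOn_mul_fst h.sign).mono (coe_subset.2 hUB))
    (by rw [card_sdiff_of_subset hD]; omega)
  have hX₂c : ((B \ D) \ X₁).card = n := by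
    rw [card_sdiff_of_subset hX₁, card_sdiff_of_subset hD]; omega
  set X₂ := (B \ D) \ X₁ with hX₂def
  have hX₂ : X₂ ⊆ B \ D := sdiff_subset
  have hcov : D ⊆ {d ∈ D | ∀ x ∈ X₂, 1 * d.1 < 1 * x.1} ∪
      {d ∈ D | ∀ x ∈ X₁, -1 * d.1 < -1 * x.1} := by
    intro d hd
    by_cases hdX : ∀ x ∈ X₂, 1 * d.1 < 1 * x.1
    · exact mem_union_left _ (mem_filter.2 ⟨hd, hdX⟩)
    · refine mem_union_right _ (mem_filter.2 ⟨hd, fun x hx => ?_⟩)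
      push Not at hdX
      obtain ⟨y, hy, hyd⟩ := hdX
      have := hlt' x hx y hy
      linarith
  have hcard := (card_le_card hcov).trans (card_union_le _ _)
  rw [hDc] at hcard
  have hsub : ∀ {X H : Finset (ℝ × ℝ)}, X ⊆ B \ D → H ⊆ D → X ∪ H ⊆ B := fun hX hH =>
    union_subset (hX.trans hUB) (hH.trans hD)
  rcases le_or_gt k #{d ∈ D | ∀ x ∈ X₂, 1 * d.1 < 1 * x.1} with hH | hH
  · have hHD : {d ∈ D | ∀ x ∈ X₂, 1 * d.1 < 1 * x.1} ⊆ D := filter_subset _ _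
    obtain ⟨s, K, hK⟩ := (h.mono Subset.rfl Subset.rfl (hsub hX₂ hHD)).exists_topDrawn hU hf hb ht
      (fun w hw x hx => hlt w (hHD hw) x (hX₂ hx)) (fun w hw x hx => (mem_filter.1 hw).2 x hx)
      hcost' hX₂c.ge hH
    refine ⟨s, K, hK.mono ?_⟩
    rw [← coe_union, ← coe_union, coe_subset]
    exact union_subset (union_subset hA hC) ((hsub hX₂ hHD).trans hB)
  · have hHD : {d ∈ D | ∀ x ∈ X₁, -1 * d.1 < -1 * x.1} ⊆ D := filter_subset _ _
    obtain ⟨s, K, hK⟩ := (h.swap.mono Subset.rfl Subset.rfl (hsub hX₁ hHD)).exists_topDrawn hU hf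
      hb ht (fun w hw x hx => hlt w (hHD hw) x (hX₁ hx))
      (fun w hw x hx => (mem_filter.1 hw).2 x hx) (by omega) hX₁c.ge
      (show k ≤ _ by omega)
    refine ⟨s, K, hK.mono ?_⟩
    rw [← coe_union, ← coe_union, coe_subset]
    exact union_subset (union_subset hC hA) ((hsub hX₁ hHD).trans hB)

/-! ### Drawing binary trees -/

/-- A tree with a very light subtree: the topmost point becomes the root, the heavier subtree is
drawn in the middle and the lighter one beside it. -/
theorem TopDrawable.drawn_light {f : ℕ → ℕ} {N : ℕ} (hU : TopDrawable α f N) {a : α}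
    {l r : BinaryTree α} (hl : l.numNodes < N) (hr : r.numNodes < N) (hr0 : r ≠ .nil)
    {P : Finset (ℝ × ℝ)} (hP : GeneralOrthogonalPosition P)
    (hc : 2 * f l.numNodes + f r.numNodes + 1 ≤ P.card) :
    ∃ s K, TopDrawn P (.node a l r) s K := by
  obtain ⟨v, hv, hvP⟩ := hP.exists_top (card_pos.1 (by omega))
  have hvP' : ∀ x ∈ P, x.1 ≠ v.1 → x.2 < v.2 := fun x hx hxv => hvP x hx fun e => hxv (by rw [e])
  set S : ℝ → Finset (ℝ × ℝ) := fun σ => {w ∈ P | σ * w.1 < σ * v.1} with hSdef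
  have hS : ∀ σ, S σ ⊆ P := fun σ => filter_subset _ _
  have hSx : ∀ σ, ∀ x ∈ S σ, σ * x.1 < σ * v.1 := fun σ x hx => (mem_filter.1 hx).2
  have hSy : ∀ σ, ∀ x ∈ S σ, x.2 < v.2 := fun σ x hx => hvP' x (hS σ hx) fun e => by
    have := hSx σ x hx
    rw [e] at this
    exact lt_irrefl _ this
  have hcov : P ⊆ insert v (S 1 ∪ S (-1)) := by
    intro w hw
    by_cases hwv : w = v
    · simp [hwv]
    · rcases lt_or_gt_of_ne (hP w hw v hv hwv).1 with hlt | hlt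
      · exact mem_insert_of_mem (mem_union_left _ (mem_filter.2 ⟨hw, by linarith⟩))
      · exact mem_insert_of_mem (mem_union_right _ (mem_filter.2 ⟨hw, by linarith⟩))
  have hcard := ((card_le_card hcov).trans (card_insert_le _ _)).trans
    (Nat.add_le_add_right (card_union_le _ _) 1)
  have hp : IsSign 1 := Or.inl rfl
  have hm : IsSign (-1) := Or.inr rfl
  have same : ∀ {σ : ℝ}, IsSign σ → f l.numNodes + f r.numNodes ≤ (S σ).card →
      ∃ s K, TopDrawn P (.node a l r) s K := fun hσ hc => by
    obtain ⟨K, hK, -⟩ := hU.drawn_same hσ (a := a) hl hr (hP.subset (hS _)) hc (hSx _) (hSy _)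
      (coe_subset.2 (hS _)) (mem_coe.2 hv)
    exact ⟨v, K, hK⟩
  by_cases h₁ : (S 1).card < f l.numNodes
  · exact same hm (by omega)
  by_cases h₂ : (S (-1)).card < f l.numNodes
  · exact same hp (by omega)
  obtain ⟨S₁, hS₁, hS₁c, hlt₁⟩ := exists_subset_card_eq_lt (fun z => 1 * z.1)
    ((hP.subset (hS 1)).injOn_mul_fst hp) (not_lt.1 h₁)
  obtain ⟨S₂, hS₂, hS₂c, hlt₂⟩ := exists_subset_card_eq_lt (fun z => -1 * z.1)
    ((hP.subset (hS (-1))).injOn_mul_fst hm) (not_lt.1 h₂)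
  set Q := (S 1 \ S₁) ∪ (S (-1) \ S₂) with hQdef
  have hQP : Q ⊆ P := union_subset (sdiff_subset.trans (hS _)) (sdiff_subset.trans (hS _))
  have hdisj : Disjoint (S 1 \ S₁) (S (-1) \ S₂) := by
    rw [Finset.disjoint_left]
    intro x hx hx'
    have := hSx 1 x (sdiff_subset hx)
    have := hSx (-1) x (sdiff_subset hx')
    linarith
  have hQc : f r.numNodes ≤ Q.card := by
    rw [hQdef, card_union_of_disjoint hdisj, card_sdiff_of_subset hS₁, card_sdiff_of_subset hS₂]
    omega
  have hQy : ∀ x ∈ Q, x.2 < v.2 := fun x hx => by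
    rcases mem_union.1 hx with hx | hx
    · exact hSy _ x (sdiff_subset hx)
    · exact hSy _ x (sdiff_subset hx)
  obtain ⟨q, K, hK⟩ := hU r hr0 hr Q (hP.subset hQP) hQc
  have hqQ := hK.drawn.root_mem
  have strip : ∀ {σ : ℝ} {T : Finset (ℝ × ℝ)}, IsSign σ → T ⊆ S σ → f l.numNodes ≤ T.card →
      (∀ a ∈ T, ∀ b ∈ Q, σ * a.1 < σ * b.1) → σ * v.1 < σ * q.1 →
      ∃ s K, TopDrawn P (.node a l r) s K := by
    intro σ T hσ hT hTc hTQ hq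
    obtain ⟨K', hK', -⟩ := hU.drawn_strip hσ (a := a) hl (hP.subset (hT.trans (hS σ))) hTc
      (fun a ha => hSx σ a (hT ha)) (fun a ha => hSy σ a (hT ha)) hK hTQ hQy (Or.inl hq)
      (coe_subset.2 (hT.trans (hS σ))) (coe_subset.2 hQP) (mem_coe.2 hv)
    exact ⟨v, K', hK'⟩
  rcases mem_union.1 hqQ with hq | hq
  · refine strip hm hS₂ hS₂c.ge (fun a ha b hb => ?_)
      (by have := hSx 1 q (sdiff_subset hq); linarith)
    rcases mem_union.1 hb with hb | hb
    · have := hSx 1 b (sdiff_subset hb)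
      have := hSx (-1) a (hS₂ ha)
      linarith
    · exact hlt₂ a ha b hb
  · refine strip hp hS₁ hS₁c.ge (fun a ha b hb => ?_)
      (by have := hSx (-1) q (sdiff_subset hq); linarith)
    rcases mem_union.1 hb with hb | hb
    · exact hlt₁ a ha b hb
    · have := hSx (-1) b (sdiff_subset hb)
      have := hSx 1 a (hS₁ ha)
      linarith

/-- The numerical properties of `f` under which `f n` points suffice for `n` vertices. -/
structure DrawingCost (f : ℕ → ℕ) (b M : ℕ) : Prop extends SpineCost f b where
  pos : 0 < b
  one : 0 < f 1
  /-- A very light subtree can be given room on both sides of the heavier one. -/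
  light : ∀ p q, p ≤ q → 1024 * p ≤ p + q + 1 → 2 * f p + f q + 1 ≤ f (p + q + 1)
  /-- There are enough points for `M + 1` groups. -/
  band_le : ∀ n, (M + 1) * bandSize f b n ≤ f n
  /-- If the lighter subtree is not very light, the points outside of the groups and not below the
  chosen group have room for `f q + 1.3 * f p`. -/
  band : ∀ p q, p ≤ q → p + q + 1 < 1024 * p →
    (M + 1) * (10 * f q + 13 * f p) + 10 * ((M + 1) * (M + 1) * bandSize f b (p + q + 1)) ≤
      10 * M * f (p + q + 1)

/-- Every binary tree with `n` nodes can be drawn on every `f n` points in general orthogonal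
position, with its root as a highest point. -/
theorem DrawingCost.topDrawable {f : ℕ → ℕ} {b M : ℕ} (hf : DrawingCost f b M) (N : ℕ) :
    TopDrawable α f N := by
  induction N with
  | zero => exact fun t _ hN => absurd hN (Nat.not_lt_zero _)
  | succ N hU =>
    intro t ht hN P hP hc
    rcases (Nat.lt_succ_iff.1 hN).lt_or_eq with hN | rfl
    · exact hU t ht hN P hP hc
    have step : ∀ (a : α) (l r : BinaryTree α), l.numNodes ≤ r.numNodes →
        TopDrawable α f (l.numNodes + r.numNodes + 1) →
        f (l.numNodes + r.numNodes + 1) ≤ P.card → ∃ s K, TopDrawn P (.node a l r) s K := by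
      intro a l r hlr hU hc
      rcases Nat.eq_zero_or_pos r.numNodes with hr | hr
      · obtain rfl : r = .nil := by
          cases r with
          | nil => rfl
          | node _ _ _ => simp at hr
        obtain rfl : l = .nil := by
          cases l with
          | nil => rfl
          | node _ _ _ => simp at hlr
        obtain ⟨v, hv⟩ := card_pos.1 (hf.one.trans_le hc)
        exact ⟨v, {v}, topDrawn_single hv⟩
      by_cases hlight : 1024 * l.numNodes ≤ l.numNodes + r.numNodes + 1
      · exact hU.drawn_light (by omega) (by omega) (by rintro rfl; simp at hr) hP
          ((hf.light _ _ hlr hlight).trans hc)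
      · refine TopDrawable.drawn_band (M := M) hU hf.toSpineCost hf.pos (by simp) hP
          ((hf.band_le _).trans hc) ?_
        simp only [heavyNodes, lightNodes, max_eq_right hlr, min_eq_left hlr]
        exact (hf.band _ _ hlr (not_le.1 hlight)).trans (Nat.mul_le_mul_left _ hc)
    cases t with
    | nil => exact absurd rfl ht
    | node a l r =>
      simp only [numNodes] at hU hc
      rcases le_total l.numNodes r.numNodes with hlr | hlr
      · exact step a l r hlr hU hc
      · rw [add_comm l.numNodes] at hU hc
        obtain ⟨s, K, hK⟩ := step a r l hlr hU hc
        exact ⟨s, K, hK.swap⟩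

/-! ### The exponent -/

theorem half_rpow_le : (1 / 2 : ℝ) ^ (0.22 : ℝ) ≤ 0.86 := by
  by_contra h
  rw [not_le] at h
  have h1 : ((1 / 2 : ℝ) ^ (0.22 : ℝ)) ^ 50 = (1 / 2) ^ 11 := by
    rw [← Real.rpow_natCast, ← Real.rpow_mul (by norm_num), ← Real.rpow_natCast]
    norm_num
  have h2 := pow_lt_pow_left₀ h (by norm_num) (show 50 ≠ 0 by norm_num)
  rw [h1] at h2
  norm_num at h2

theorem rpow_eq_mul_rpow {y : ℝ} (hy : 0 ≤ y) : y ^ (1.22 : ℝ) = y * y ^ (0.22 : ℝ) := by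
  rw [show (1.22 : ℝ) = 1 + 0.22 by norm_num, Real.rpow_add' hy (by norm_num), Real.rpow_one]

theorem rpow_le_of_le_half {y : ℝ} (hy : 0 ≤ y) (hy' : y ≤ 1 / 2) :
    y ^ (1.22 : ℝ) ≤ 0.86 * y := by
  rw [rpow_eq_mul_rpow hy, mul_comm]
  refine mul_le_mul_of_nonneg_right ?_ hy
  exact (Real.rpow_le_rpow hy hy' (by norm_num)).trans half_rpow_le

theorem rpow_le_of_le_small {y : ℝ} (hy : 0 ≤ y) (hy' : y ≤ 1 / 1024) :
    y ^ (1.22 : ℝ) ≤ 0.23 * y := by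
  rw [rpow_eq_mul_rpow hy, mul_comm]
  refine mul_le_mul_of_nonneg_right ?_ hy
  have h1 : (1 / 1024 : ℝ) ^ (0.22 : ℝ) = ((1 / 2 : ℝ) ^ (0.22 : ℝ)) ^ 10 := by
    rw [← Real.rpow_natCast, ← Real.rpow_mul (by norm_num), mul_comm, Real.rpow_mul (by norm_num),
      Real.rpow_natCast]
    norm_num
  refine (Real.rpow_le_rpow hy hy' (by norm_num)).trans ?_
  rw [h1]
  refine (pow_le_pow_left₀ (by positivity) half_rpow_le 10).trans (by norm_num)

/-- The convex function `y ^ 1.22` lies below its chord on the interval from `1 / 2` to `1`. -/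
theorem one_sub_rpow_le {y : ℝ} (hy : 0 ≤ y) (hy' : y ≤ 1 / 2) :
    (1 - y) ^ (1.22 : ℝ) ≤ 1 - 1.14 * y := by
  have h1 := (convexOn_rpow (p := 1.22) (by norm_num)).2 (show (1 : ℝ) ∈ Set.Ici 0 by simp)
    (show (1 / 2 : ℝ) ∈ Set.Ici 0 by simp) (show 0 ≤ 1 - 2 * y by linarith)
    (show 0 ≤ 2 * y by linarith) (by ring)
  simp only [Real.one_rpow, smul_eq_mul] at h1
  rw [show (1 - 2 * y) * 1 + 2 * y * (1 / 2) = 1 - y by ring] at h1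
  have h3 := rpow_le_of_le_half (y := 1 / 2) (by norm_num) le_rfl
  nlinarith

/-- A number of points that suffices for `n` vertices; the large factor absorbs the rounding
errors. -/
noncomputable def pointCount (n : ℕ) : ℕ := ⌈(10 : ℝ) ^ 30 * (n : ℝ) ^ (1.22 : ℝ)⌉₊

theorem pointCount_zero : pointCount 0 = 0 := by
  simp [pointCount, Real.zero_rpow (show (1.22 : ℝ) ≠ 0 by norm_num)]

theorem monotone_pointCount : Monotone pointCount := fun m n h => by
  refine Nat.ceil_mono (mul_le_mul_of_nonneg_left ?_ (by positivity))
  exact Real.rpow_le_rpow (by positivity) (by exact_mod_cast h) (by norm_num)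

theorem le_pointCount (n : ℕ) : (10 : ℝ) ^ 30 * (n : ℝ) ^ (1.22 : ℝ) ≤ pointCount n :=
  Nat.le_ceil _

theorem pointCount_le (n : ℕ) :
    (pointCount n : ℝ) ≤ (10 : ℝ) ^ 30 * (n : ℝ) ^ (1.22 : ℝ) + 1 :=
  (Nat.ceil_lt_add_one (by positivity)).le

theorem pointCount_succ (n : ℕ) : pointCount n + 1 ≤ pointCount (n + 1) := by
  have h1 := Real.add_rpow_le_rpow_add (a := n) (b := 1) (p := 1.22) (by positivity) (by norm_num)
    (by norm_num)
  have h2 : (10 : ℝ) ^ 30 * (n : ℝ) ^ (1.22 : ℝ) + 1 ≤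
      (10 : ℝ) ^ 30 * ((n + 1 : ℕ) : ℝ) ^ (1.22 : ℝ) := by
    rw [Real.one_rpow] at h1
    push_cast
    nlinarith
  calc pointCount n + 1 = ⌈(10 : ℝ) ^ 30 * (n : ℝ) ^ (1.22 : ℝ) + 1⌉₊ :=
        (Nat.ceil_add_one (by positivity)).symm
    _ ≤ _ := Nat.ceil_mono h2

/-- The numbers of points for the two subtrees of a tree with `n` nodes, `p = y * n` of them in the
lighter subtree, compared with the number `a` for the whole tree. The rounding errors are small
against `y * a`. -/
theorem exists_pointCount_bounds {p q : ℕ} (hpq : p ≤ q) (hp : 0 < p) :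
    ∃ a y : ℝ, a = (10 : ℝ) ^ 30 * ((p + q + 1 : ℕ) : ℝ) ^ (1.22 : ℝ) ∧
      y * (p + q + 1 : ℕ) = p ∧ 0 ≤ y ∧ y ≤ 1 / 2 ∧ (10 : ℝ) ^ 30 ≤ y * a ∧
      (pointCount p : ℝ) ≤ 0.86 * (y * a) + 1 ∧
      (1024 * p ≤ p + q + 1 → (pointCount p : ℝ) ≤ 0.23 * (y * a) + 1) ∧
      (pointCount q : ℝ) ≤ a - 1.14 * (y * a) + 1 ∧ a ≤ pointCount (p + q + 1) := by
  have hn : (0 : ℝ) < (p + q + 1 : ℕ) := by positivity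
  have hn1 : (1 : ℝ) ≤ (p + q + 1 : ℕ) := by exact_mod_cast Nat.le_add_left 1 _
  set n : ℝ := ((p + q + 1 : ℕ) : ℝ) with hndef
  set y : ℝ := p / n with hy
  have hyn : y * n = p := div_mul_cancel₀ _ hn.ne'
  have hy0 : 0 ≤ y := by positivity
  have hpq' : (p : ℝ) ≤ q := by exact_mod_cast hpq
  have hnpq : n = p + q + 1 := by rw [hndef]; push_cast; ring
  have hy1 : y ≤ 1 / 2 := by
    rw [hy, div_le_iff₀ hn]; linarith
  have hnn : n ≤ n ^ (1.22 : ℝ) := by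
    conv_lhs => rw [← Real.rpow_one n]
    exact Real.rpow_le_rpow_of_exponent_le hn1 (by norm_num)
  have hnpos : 0 < n ^ (1.22 : ℝ) := hn.trans_le hnn
  have hpn : (p : ℝ) ^ (1.22 : ℝ) = y ^ (1.22 : ℝ) * n ^ (1.22 : ℝ) := by
    rw [← hyn, Real.mul_rpow hy0 hn.le]
  have hqn : (q : ℝ) ^ (1.22 : ℝ) ≤ (1 - y) ^ (1.22 : ℝ) * n ^ (1.22 : ℝ) := by
    rw [← Real.mul_rpow (by linarith) hn.le]
    refine Real.rpow_le_rpow (by positivity) ?_ (by norm_num)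
    rw [sub_mul, hyn]; linarith
  refine ⟨_, y, rfl, hyn, hy0, hy1, ?_, ?_, ?_, ?_, le_pointCount _⟩
  · have h1 : (1 : ℝ) ≤ p := by exact_mod_cast hp
    have h2 := mul_le_mul_of_nonneg_left hnn hy0
    rw [hyn] at h2
    nlinarith
  · refine (pointCount_le p).trans ?_
    rw [hpn]
    have := mul_le_mul_of_nonneg_right (rpow_le_of_le_half hy0 hy1) hnpos.le
    nlinarith
  · intro hlight
    refine (pointCount_le p).trans ?_
    rw [hpn]
    have hy2 : y ≤ 1 / 1024 := by
      have : (1024 * p : ℝ) ≤ n := by rw [hndef]; exact_mod_cast hlight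
      rw [hy, div_le_iff₀ hn]; linarith
    have := mul_le_mul_of_nonneg_right (rpow_le_of_le_small hy0 hy2) hnpos.le
    nlinarith
  · refine (pointCount_le q).trans ?_
    have := mul_le_mul_of_nonneg_right (one_sub_rpow_le hy0 hy1) hnpos.le
    nlinarith

/-- The group of points that carries the spine is small against the number of all points. -/
theorem bandSize_le (n : ℕ) (hn : 0 < n) :
    (10 : ℝ) ^ 10 * bandSize pointCount (10 ^ 11) n ≤
      (10 : ℝ) ^ 30 * (n : ℝ) ^ (1.22 : ℝ) := by
  have hn1 : (1 : ℝ) ≤ n := by exact_mod_cast hn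
  have hnn : (n : ℝ) ≤ (n : ℝ) ^ (1.22 : ℝ) := by
    conv_lhs => rw [← Real.rpow_one (n : ℝ)]
    exact Real.rpow_le_rpow_of_exponent_le hn1 (by norm_num)
  have h1 : (((n / 10 ^ 11 : ℕ) : ℝ)) ^ (1.22 : ℝ) ≤ (n : ℝ) ^ (1.22 : ℝ) / 10 ^ 11 := by
    have h2 : ((n / 10 ^ 11 : ℕ) : ℝ) ≤ n / 10 ^ 11 := by
      exact_mod_cast Nat.cast_div_le (α := ℝ) (m := n) (n := 10 ^ 11)
    refine (Real.rpow_le_rpow (by positivity) h2 (by norm_num)).trans ?_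
    rw [Real.div_rpow (by positivity) (by positivity)]
    refine div_le_div_of_nonneg_left (by positivity) (by positivity) ?_
    conv_lhs => rw [← Real.rpow_one ((10 : ℝ) ^ 11)]
    exact Real.rpow_le_rpow_of_exponent_le (by norm_num) (by norm_num)
  have h3 := pointCount_le (n / 10 ^ 11)
  rw [bandSize]
  push_cast
  rw [le_div_iff₀ (by positivity)] at h1
  norm_num at h1 h3 ⊢
  linarith

/-- With `y = p / n` and `a` the number of points for `n` nodes, the chord bounds for `y ^ 1.22` and
`(1 - y) ^ 1.22` give `10 * f q + 13 * f p ≤ (10 - 0.22 * y) * a` up to rounding. For `y ≥ 1 / 1024`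
the saving exceeds the fraction `10 / 10 ^ 5` lost below a group when there are `10 ^ 5` groups, and
`b = 10 ^ 11` makes the groups themselves negligible. -/
theorem drawingCost_pointCount : DrawingCost pointCount (10 ^ 11) (10 ^ 5 - 1) where
  zero := pointCount_zero
  mono := monotone_pointCount
  heavy_add_light p q hpq := by
    rcases Nat.eq_zero_or_pos p with rfl | hp
    · have := monotone_pointCount (show q ≤ 0 + q + 1 by omega)
      rw [pointCount_zero]
      omega
    obtain ⟨a, y, -, -, hy, hy', hya, h1, -, h2, h3⟩ := exists_pointCount_bounds hpq hp
    rify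
    linarith
  heavy_add_two_light p q hpq := by
    rcases Nat.eq_zero_or_pos p with rfl | hp
    · have := monotone_pointCount (show q ≤ 0 + q + 1 by omega)
      rw [pointCount_zero]
      omega
    obtain ⟨a, y, -, -, hy, hy', hya, h1, -, h2, h3⟩ := exists_pointCount_bounds hpq hp
    have ha : 0 ≤ a := by
      by_contra ha
      nlinarith
    have h4 := mul_le_mul_of_nonneg_right hy' ha
    rify
    linarith
  gain p q hpq hb := by
    rcases Nat.eq_zero_or_pos p with rfl | hp
    · omega
    obtain ⟨a, y, -, hyn, hy, hy', hya, h1, -, h2, h3⟩ := exists_pointCount_bounds hpq hp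
    have ha : 0 ≤ a := by
      by_contra ha
      nlinarith
    have hb' : ((p + q + 1 : ℕ) : ℝ) ≤ 10 ^ 11 * p := by exact_mod_cast hb
    have hn : (0 : ℝ) < (p + q + 1 : ℕ) := by positivity
    have hyb : 1 ≤ 10 ^ 11 * y := by
      rw [← hyn] at hb'
      by_contra hlt
      nlinarith
    have h4 := mul_le_mul_of_nonneg_right hyb ha
    rify
    norm_num at h4 hya ⊢
    linarith
  pos := by norm_num
  one := by
    exact (Nat.succ_pos _).trans_le (pointCount_succ 0)
  light p q hpq hlight := by
    rcases Nat.eq_zero_or_pos p with rfl | hp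
    · have := pointCount_succ q
      rw [pointCount_zero, zero_add]
      omega
    obtain ⟨a, y, -, -, hy, hy', hya, -, h1, h2, h3⟩ := exists_pointCount_bounds hpq hp
    have h1 := h1 hlight
    rify
    linarith
  band_le n := by
    rcases Nat.eq_zero_or_pos n with rfl | hn
    · simp [bandSize, pointCount_zero]
    have h1 := bandSize_le n hn
    have h2 := le_pointCount n
    have h3 : (10 : ℝ) ^ 10 * bandSize pointCount (10 ^ 11) n ≤ pointCount n := h1.trans h2
    rify
    norm_num at h3 ⊢
    nlinarith [(Nat.cast_nonneg (bandSize pointCount 100000000000 n) : (0 : ℝ) ≤ _)]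
  band p q hpq hband := by
    have hp : 0 < p := by omega
    obtain ⟨a, y, ha, hyn, hy, hy', hya, h1, -, h2, h3⟩ := exists_pointCount_bounds hpq hp
    have h5 := bandSize_le (p + q + 1) (by omega)
    rw [← ha] at h5
    have ha : 0 ≤ a := by
      by_contra ha
      nlinarith
    have hn : (0 : ℝ) < (p + q + 1 : ℕ) := by positivity
    have hb' : ((p + q + 1 : ℕ) : ℝ) ≤ 1024 * p := by exact_mod_cast hband.le
    have hyb : 1 ≤ 1024 * y := by
      rw [← hyn] at hb'
      by_contra hlt
      nlinarith
    have h4 := mul_le_mul_of_nonneg_right hyb ha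
    rify
    norm_num at h5 h4 hya h3 ⊢
    linarith

/-! ### Trees of maximum degree three as binary trees -/

/-- The set of labels of a binary tree. -/
def labels : BinaryTree α → Set α
  | .nil => ∅
  | .node a l r => insert a (labels l ∪ labels r)

/-- The set of pairs of labels of parent and child, for the binary tree hanging from `x`. -/
def treeEdges : α → BinaryTree α → Set (Sym2 α)
  | _, .nil => ∅
  | x, .node a l r => insert s(x, a) (treeEdges a l ∪ treeEdges a r)

/-- The labels of the binary tree are pairwise different vertices of `G`, and each of them is
adjacent to the label of its parent; the parent of the root is `x`. -/
def HangsIn (G : SimpleGraph α) : α → BinaryTree α → Prop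
  | _, .nil => True
  | x, .node a l r => G.Adj x a ∧ a ∉ labels l ∧ a ∉ labels r ∧ Disjoint (labels l) (labels r) ∧
      HangsIn G a l ∧ HangsIn G a r

theorem HangsIn.ncard_labels [Finite α] {G : SimpleGraph α} {x : α} {t : BinaryTree α}
    (h : HangsIn G x t) : (labels t).ncard = t.numNodes := by
  induction t generalizing x with
  | nil => simp [labels]
  | node a l r ihl ihr =>
    obtain ⟨-, hal, har, hd, hl, hr⟩ := h
    rw [labels, Set.ncard_insert_of_notMem (by simp [hal, har]), Set.ncard_union_eq hd, ihl hl,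
      ihr hr, numNodes]

/-- A neighbour `w` of a label `u` can be added to the tree: as the degree of `u` is at most three,
`u` has at most one child among the labels. -/
theorem HangsIn.exists_insert [Fintype α] {G : SimpleGraph α} [DecidableRel G.Adj]
    (hdeg : ∀ v, G.degree v ≤ 3) {x u w : α} {t : BinaryTree α} (h : HangsIn G x t)
    (hx : x ∉ labels t) (hu : u ∈ labels t) (hw : w ∉ labels t) (hwx : w ≠ x) (huw : G.Adj u w) :
    ∃ t', HangsIn G x t' ∧ labels t' = insert w (labels t) := by
  induction t generalizing x with
  | nil => exact absurd hu (Set.notMem_empty u)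
  | node a l r ihl ihr =>
    obtain ⟨hxa, hal, har, hd, hl, hr⟩ := h
    simp only [labels, Set.mem_insert_iff, Set.mem_union, not_or] at hx hu hw
    by_cases hua : u = a
    · subst hua
      cases l with
      | nil =>
        refine ⟨.node u (.node w .nil .nil) r,
          ⟨hxa, ?_, har, ?_, ⟨huw, by simp [labels, HangsIn]⟩, hr⟩, ?_⟩
        · simpa [labels] using huw.ne
        · simpa [labels] using hw.2.2
        · ext; simp only [labels, Set.mem_insert_iff, Set.mem_union, Set.mem_empty_iff_false]; tauto
      | node b l₁ l₂ =>
        cases r with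
        | nil =>
          refine ⟨.node u (.node b l₁ l₂) (.node w .nil .nil),
            ⟨hxa, hal, ?_, ?_, hl, ⟨huw, by simp [labels, HangsIn]⟩⟩, ?_⟩
          · simpa [labels] using huw.ne
          · have hwl := hw.2.1
            simp only [labels, Set.union_empty, insert_empty_eq, Set.disjoint_singleton_right]
            exact hwl
          · ext; simp only [labels, Set.mem_insert_iff, Set.mem_union, Set.mem_empty_iff_false]
            tauto
        | node c r₁ r₂ =>
          exfalso
          classical
          have hb : b ∈ labels (.node b l₁ l₂) := Set.mem_insert _ _
          have hc : c ∈ labels (.node c r₁ r₂) := Set.mem_insert _ _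
          have hbc : b ≠ c := fun e => Set.disjoint_left.1 hd hb (e ▸ hc)
          have hxb : x ≠ b := fun e => hx.2.1 (e ▸ hb)
          have hxc : x ≠ c := fun e => hx.2.2 (e ▸ hc)
          have hwb : w ≠ b := fun e => hw.2.1 (e ▸ hb)
          have hwc : w ≠ c := fun e => hw.2.2 (e ▸ hc)
          have hsub : ({x, w, b, c} : Finset α) ⊆ G.neighborFinset u := by
            intro v hv
            simp only [Finset.mem_insert, Finset.mem_singleton] at hv
            rw [SimpleGraph.mem_neighborFinset]
            rcases hv with rfl | rfl | rfl | rfl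
            exacts [hxa.symm, huw, hl.1, hr.1]
          have hcard := card_le_card hsub
          rw [SimpleGraph.card_neighborFinset_eq_degree] at hcard
          have h4 : ({x, w, b, c} : Finset α).card = 4 := by
            rw [card_insert_of_notMem, card_insert_of_notMem, card_pair hbc] <;> simp [*, hwx.symm]
          have := hdeg u
          omega
    · rcases hu with hu | hu | hu
      · exact absurd hu hua
      · obtain ⟨t', ht', hlab⟩ := ihl hl hal hu hw.2.1 hw.1
        refine ⟨.node a t' r, ⟨hxa, ?_, har, ?_, ht', hr⟩, ?_⟩
        · rw [hlab, Set.mem_insert_iff, not_or]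
          exact ⟨fun e => hw.1 e.symm, hal⟩
        · rw [hlab, Set.disjoint_insert_left]
          exact ⟨hw.2.2, hd⟩
        · rw [labels, labels, hlab, Set.insert_union, Set.insert_comm]
      · obtain ⟨t', ht', hlab⟩ := ihr hr har hu hw.2.2 hw.1
        refine ⟨.node a l t', ⟨hxa, hal, ?_, ?_, hl, ht'⟩, ?_⟩
        · rw [hlab, Set.mem_insert_iff, not_or]
          exact ⟨fun e => hw.1 e.symm, har⟩
        · rw [hlab, Set.disjoint_insert_right]
          exact ⟨hw.2.1, hd⟩
        · rw [labels, labels, hlab, Set.union_insert, Set.insert_comm]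

theorem HangsIn.treeEdges_subset {G : SimpleGraph α} {x : α} {t : BinaryTree α}
    (h : HangsIn G x t) : treeEdges x t ⊆ G.edgeSet := by
  induction t generalizing x with
  | nil => exact Set.empty_subset _
  | node a l r ihl ihr =>
    exact Set.insert_subset h.1 (Set.union_subset (ihl h.2.2.2.2.1) (ihr h.2.2.2.2.2))

theorem reachable_of_mem_labels {H : SimpleGraph α} {x v : α} {t : BinaryTree α}
    (h : treeEdges x t ⊆ H.edgeSet) (hv : v ∈ labels t) : H.Reachable x v := by
  induction t generalizing x with
  | nil => exact absurd hv (Set.notMem_empty v)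
  | node a l r ihl ihr =>
    rw [treeEdges, Set.insert_subset_iff, Set.union_subset_iff] at h
    have hxa : H.Reachable x a := SimpleGraph.Adj.reachable h.1
    rcases hv with rfl | hv | hv
    exacts [hxa, hxa.trans (ihl h.2.1 hv), hxa.trans (ihr h.2.2 hv)]

/-- A tree of maximum degree at most three is a binary tree hanging from one of its leaves. -/
theorem exists_hangsIn [Fintype α] {G : SimpleGraph α} [DecidableRel G.Adj] (hG : G.IsTree)
    (hdeg : ∀ v, G.degree v ≤ 3) :
    ∃ (x : α) (t : BinaryTree α), HangsIn G x t ∧ x ∉ labels t ∧ insert x (labels t) = Set.univ ∧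
      treeEdges x t = G.edgeSet := by
  obtain ⟨x, hx⟩ : ∃ x, G.degree x ≤ 1 := by
    rcases subsingleton_or_nontrivial α with hs | hn
    · obtain ⟨x⟩ := hG.connected.nonempty
      refine ⟨x, ?_⟩
      have := G.degree_lt_card_verts x
      have := Fintype.card_le_one_iff_subsingleton.2 hs
      omega
    · obtain ⟨x, hx⟩ := hG.exists_vert_degree_one_of_nontrivial
      exact ⟨x, hx.le⟩
  have grow : ∀ k ≤ Fintype.card α, ∃ t, HangsIn G x t ∧ x ∉ labels t ∧
      k ≤ (insert x (labels t)).ncard := by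
    intro k
    induction k with
    | zero => exact fun _ => ⟨.nil, trivial, Set.notMem_empty x, Nat.zero_le _⟩
    | succ k ih =>
      intro hk
      obtain ⟨t, ht, hxt, hkt⟩ := ih (by omega)
      by_cases huniv : insert x (labels t) = Set.univ
      · exact ⟨t, ht, hxt, by rw [huniv, Set.ncard_univ, Nat.card_eq_fintype_card]; exact hk⟩
      obtain ⟨v, hv⟩ := (Set.ne_univ_iff_exists_notMem _).1 huniv
      obtain ⟨p⟩ := hG.connected.preconnected x v
      obtain ⟨d, -, hu, hw⟩ := p.exists_boundary_dart _ (Set.mem_insert _ _) hv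
      have huw := d.adj
      rw [Set.mem_insert_iff, not_or] at hw
      suffices hsuff : ∃ t', HangsIn G x t' ∧ labels t' = insert d.snd (labels t) by
        obtain ⟨t', ht', hlab⟩ := hsuff
        refine ⟨t', ht', ?_, ?_⟩
        · rw [hlab, Set.mem_insert_iff, not_or]
          exact ⟨fun e => hw.1 e.symm, hxt⟩
        · rw [hlab, Set.insert_comm, Set.ncard_insert_of_notMem (by simp [hw])]
          omega
      rcases Set.mem_insert_iff.1 hu with hu | hu
      · rw [hu] at huw
        cases t with
        | nil =>
          exact ⟨.node d.snd .nil .nil, ⟨huw, by simp [labels, HangsIn]⟩, by simp [labels]⟩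
        | node b l r =>
          exfalso
          classical
          have hwb : d.snd ≠ b := fun e => hw.2 (e ▸ Set.mem_insert _ _)
          have hsub : ({d.snd, b} : Finset α) ⊆ G.neighborFinset x := by
            intro v hv
            simp only [Finset.mem_insert, Finset.mem_singleton] at hv
            rw [SimpleGraph.mem_neighborFinset]
            rcases hv with rfl | rfl
            exacts [huw, ht.1]
          have hcard := card_le_card hsub
          rw [SimpleGraph.card_neighborFinset_eq_degree, card_pair hwb] at hcard
          omega
      · exact ht.exists_insert hdeg hxt hu hw.2 hw.1 huw
  obtain ⟨t, ht, hxt, hc⟩ := grow _ le_rfl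
  have huniv : insert x (labels t) = Set.univ := by
    refine Set.eq_of_subset_of_ncard_le (Set.subset_univ _) ?_
    rwa [Set.ncard_univ, Nat.card_eq_fintype_card]
  refine ⟨x, t, ht, hxt, huniv, ?_⟩
  have hsub := ht.treeEdges_subset
  set H := SimpleGraph.fromEdgeSet (treeEdges x t) with hH
  have hHe : H.edgeSet = treeEdges x t := by
    rw [hH, SimpleGraph.edgeSet_fromEdgeSet, sdiff_eq_left, Set.disjoint_left]
    exact fun e he => G.not_isDiag_of_mem_edgeSet (hsub he)
  have hHG : H ≤ G := by
    rw [← SimpleGraph.edgeSet_subset_edgeSet, hHe]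
    exact hsub
  have hreach : ∀ v, H.Reachable x v := fun v => by
    have hv : v ∈ insert x (labels t) := huniv ▸ Set.mem_univ v
    rcases hv with rfl | hv
    · exact SimpleGraph.Reachable.refl _
    · exact reachable_of_mem_labels hHe.ge hv
  have hconn : H.Connected := by
    have : Nonempty α := ⟨x⟩
    exact ⟨fun u v => (hreach u).symm.trans (hreach v)⟩
  have := (SimpleGraph.isTree_iff_minimal_connected.1 hG).eq_of_le hconn hHG
  rw [← hHe, this]

/-! ### Drawings of graphs from drawings of binary trees -/

/-- The vertices of `L` are placed at points of `S` and the edges of `E` between them are drawn as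
L-shaped paths within `K`, without crossings. -/
structure IsPlacement (S : Set (ℝ × ℝ)) (L : Set α) (E : Set (Sym2 α)) (K : Set (ℝ × ℝ))
    (pos : α → ℝ × ℝ) (curve : Sym2 α → Set (ℝ × ℝ)) : Prop where
  pos_mem : ∀ v ∈ L, pos v ∈ S
  pos_mem_cover : ∀ v ∈ L, pos v ∈ K
  injOn : Set.InjOn pos L
  adj : ∀ u v, s(u, v) ∈ E → u ∈ L ∧ v ∈ L ∧ u ≠ v
  curve_eq : ∀ u v, s(u, v) ∈ E →
    curve s(u, v) = LPath (pos u) (pos v) ∨ curve s(u, v) = LPath (pos v) (pos u)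
  curve_subset : ∀ e ∈ E, curve e ⊆ K
  pos_mem_curve : ∀ e ∈ E, ∀ w ∈ L, pos w ∈ curve e → w ∈ e
  curve_inter : ∀ e ∈ E, ∀ e' ∈ E, e ≠ e' → ∀ z, z ∈ curve e → z ∈ curve e' →
    ∃ w, w ∈ e ∧ w ∈ e' ∧ pos w = z

theorem isPlacement_vertex {S : Set (ℝ × ℝ)} {x : α} {p : ℝ × ℝ} (hp : p ∈ S) :
    IsPlacement S {x} ∅ {p} (fun _ => p) (fun _ => ∅) where
  pos_mem _ _ := hp
  pos_mem_cover _ _ := rfl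
  injOn := Set.injOn_singleton _ _
  adj _ _ h := absurd h (Set.notMem_empty _)
  curve_eq _ _ h := absurd h (Set.notMem_empty _)
  curve_subset _ h := absurd h (Set.notMem_empty _)
  pos_mem_curve _ h := absurd h (Set.notMem_empty _)
  curve_inter _ h := absurd h (Set.notMem_empty _)

theorem exists_isPlacement_edge {S : Set (ℝ × ℝ)} {x a : α} (hxa : x ≠ a) {p q : ℝ × ℝ}
    {e : Set (ℝ × ℝ)} (hp : p ∈ S) (hq : q ∈ S) (hpq : p ≠ q)
    (he : e = LPath p q ∨ e = LPath q p) :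
    ∃ pos curve, IsPlacement S {x, a} {s(x, a)} e pos curve ∧ pos x = p ∧ pos a = q := by
  classical
  have hpe : p ∈ e := by
    rcases he with rfl | rfl
    exacts [left_mem_LPath _ _, right_mem_LPath _ _]
  have hqe : q ∈ e := by
    rcases he with rfl | rfl
    exacts [right_mem_LPath _ _, left_mem_LPath _ _]
  obtain ⟨pos, h1, h2⟩ : ∃ pos : α → ℝ × ℝ, pos x = p ∧ pos a = q :=
    ⟨fun v => if v = x then p else q, if_pos rfl, if_neg hxa.symm⟩
  refine ⟨pos, fun _ => e, ⟨?_, ?_, ?_, ?_, ?_, ?_, ?_, ?_⟩, h1, h2⟩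
  · rintro v (rfl | rfl)
    · rwa [h1]
    · rwa [h2]
  · rintro v (rfl | rfl)
    · rwa [h1]
    · rwa [h2]
  · rintro v (rfl | rfl) w (rfl | rfl) hvw
    · rfl
    · rw [h1, h2] at hvw; exact absurd hvw hpq
    · rw [h1, h2] at hvw; exact absurd hvw.symm hpq
    · rfl
  · intro u v huv
    rw [Set.mem_singleton_iff, Sym2.eq_iff] at huv
    rcases huv with ⟨rfl, rfl⟩ | ⟨rfl, rfl⟩
    · exact ⟨Or.inl rfl, Or.inr rfl, hxa⟩
    · exact ⟨Or.inr rfl, Or.inl rfl, hxa.symm⟩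
  · intro u v huv
    rw [Set.mem_singleton_iff, Sym2.eq_iff] at huv
    rcases huv with ⟨rfl, rfl⟩ | ⟨rfl, rfl⟩
    · rwa [h1, h2]
    · rw [h1, h2]; exact he.symm
  · exact fun _ _ => Set.Subset.rfl
  · rintro _ rfl w (rfl | rfl) -
    · exact Sym2.mem_mk_left _ _
    · exact Sym2.mem_mk_right _ _
  · rintro _ rfl _ rfl h
    exact absurd rfl h

/-- Two drawings that share a single vertex, and no other point, form one drawing. -/
theorem IsPlacement.glue {S : Set (ℝ × ℝ)} {L₁ L₂ : Set α} {E₁ E₂ : Set (Sym2 α)}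
    {K₁ K₂ : Set (ℝ × ℝ)} {pos₁ pos₂ : α → ℝ × ℝ} {curve₁ curve₂ : Sym2 α → Set (ℝ × ℝ)}
    (h₁ : IsPlacement S L₁ E₁ K₁ pos₁ curve₁) (h₂ : IsPlacement S L₂ E₂ K₂ pos₂ curve₂)
    {x : α} {p : ℝ × ℝ} (hx₁ : x ∈ L₁) (hx₂ : x ∈ L₂) (hp₁ : pos₁ x = p) (hp₂ : pos₂ x = p)
    (hL : ∀ v ∈ L₁, v ∈ L₂ → v = x) (hK : K₁ ∩ K₂ ⊆ {p}) :
    ∃ pos curve, IsPlacement S (L₁ ∪ L₂) (E₁ ∪ E₂) (K₁ ∪ K₂) pos curve ∧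
      (∀ v ∈ L₁, pos v = pos₁ v) ∧ ∀ v ∈ L₂, pos v = pos₂ v := by
  classical
  obtain ⟨pos, hpos₁, hpos₂⟩ : ∃ pos : α → ℝ × ℝ,
      (∀ v ∈ L₁, pos v = pos₁ v) ∧ ∀ v ∈ L₂, pos v = pos₂ v := by
    refine ⟨fun v => if v ∈ L₁ then pos₁ v else pos₂ v, fun v hv => if_pos hv, fun v hv => ?_⟩
    by_cases hv₁ : v ∈ L₁
    · rw [hL v hv₁ hv, hp₂, ← hp₁]
      exact if_pos hx₁
    · exact if_neg hv₁
  obtain ⟨curve, hcurve₁, hcurve₂⟩ : ∃ curve : Sym2 α → Set (ℝ × ℝ),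
      (∀ e ∈ E₁, curve e = curve₁ e) ∧ ∀ e ∈ E₂, curve e = curve₂ e := by
    refine ⟨fun e => if e ∈ E₁ then curve₁ e else curve₂ e, fun e he => if_pos he,
      fun e he => if_neg fun he' => ?_⟩
    induction e with
    | _ u v =>
      obtain ⟨hu, hv, huv⟩ := h₁.adj u v he'
      obtain ⟨hu', hv', -⟩ := h₂.adj u v he
      exact huv ((hL u hu hu').trans (hL v hv hv').symm)
  -- The two drawings meet at the point of the common vertex only.
  have hx_of₁ : ∀ w ∈ L₁, pos₁ w ∈ K₂ → w = x := fun w hw hwK =>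
    h₁.injOn hw hx₁ ((show pos₁ w = p from hK ⟨h₁.pos_mem_cover w hw, hwK⟩).trans hp₁.symm)
  have hx_of₂ : ∀ w ∈ L₂, pos₂ w ∈ K₁ → w = x := fun w hw hwK =>
    h₂.injOn hw hx₂ ((show pos₂ w = p from hK ⟨hwK, h₂.pos_mem_cover w hw⟩).trans hp₂.symm)
  have hinter : ∀ e₁ ∈ E₁, ∀ e₂ ∈ E₂, ∀ z, z ∈ curve₁ e₁ → z ∈ curve₂ e₂ →
      x ∈ e₁ ∧ x ∈ e₂ ∧ pos x = z := by
    intro e₁ he₁ e₂ he₂ z hz₁ hz₂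
    obtain rfl : z = p := hK ⟨h₁.curve_subset e₁ he₁ hz₁, h₂.curve_subset e₂ he₂ hz₂⟩
    exact ⟨h₁.pos_mem_curve e₁ he₁ x hx₁ (hp₁ ▸ hz₁), h₂.pos_mem_curve e₂ he₂ x hx₂ (hp₂ ▸ hz₂),
      (hpos₁ x hx₁).trans hp₁⟩
  refine ⟨pos, curve, ⟨?_, ?_, ?_, ?_, ?_, ?_, ?_, ?_⟩, hpos₁, hpos₂⟩
  · rintro v (hv | hv)
    · rw [hpos₁ v hv]; exact h₁.pos_mem v hv
    · rw [hpos₂ v hv]; exact h₂.pos_mem v hv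
  · rintro v (hv | hv)
    · rw [hpos₁ v hv]; exact Or.inl (h₁.pos_mem_cover v hv)
    · rw [hpos₂ v hv]; exact Or.inr (h₂.pos_mem_cover v hv)
  · rintro v (hv | hv) w (hw | hw) hvw
    · rw [hpos₁ v hv, hpos₁ w hw] at hvw
      exact h₁.injOn hv hw hvw
    · rw [hpos₁ v hv, hpos₂ w hw] at hvw
      rw [hx_of₁ v hv (hvw ▸ h₂.pos_mem_cover w hw), hx_of₂ w hw (hvw ▸ h₁.pos_mem_cover v hv)]
    · rw [hpos₂ v hv, hpos₁ w hw] at hvw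
      rw [hx_of₂ v hv (hvw ▸ h₁.pos_mem_cover w hw), hx_of₁ w hw (hvw ▸ h₂.pos_mem_cover v hv)]
    · rw [hpos₂ v hv, hpos₂ w hw] at hvw
      exact h₂.injOn hv hw hvw
  · rintro u v (he | he)
    · obtain ⟨hu, hv, huv⟩ := h₁.adj u v he
      exact ⟨Or.inl hu, Or.inl hv, huv⟩
    · obtain ⟨hu, hv, huv⟩ := h₂.adj u v he
      exact ⟨Or.inr hu, Or.inr hv, huv⟩
  · rintro u v (he | he)
    · obtain ⟨hu, hv, -⟩ := h₁.adj u v he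
      rw [hcurve₁ _ he, hpos₁ u hu, hpos₁ v hv]
      exact h₁.curve_eq u v he
    · obtain ⟨hu, hv, -⟩ := h₂.adj u v he
      rw [hcurve₂ _ he, hpos₂ u hu, hpos₂ v hv]
      exact h₂.curve_eq u v he
  · rintro e (he | he)
    · rw [hcurve₁ e he]
      exact (h₁.curve_subset e he).trans Set.subset_union_left
    · rw [hcurve₂ e he]
      exact (h₂.curve_subset e he).trans Set.subset_union_right
  · rintro e (he | he) w (hw | hw) hwe
    · rw [hcurve₁ e he, hpos₁ w hw] at hwe
      exact h₁.pos_mem_curve e he w hw hwe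
    · rw [hcurve₁ e he, hpos₂ w hw] at hwe
      obtain rfl := hx_of₂ w hw (h₁.curve_subset e he hwe)
      exact h₁.pos_mem_curve e he w hx₁ (by rwa [hp₁, ← hp₂])
    · rw [hcurve₂ e he, hpos₁ w hw] at hwe
      obtain rfl := hx_of₁ w hw (h₂.curve_subset e he hwe)
      exact h₂.pos_mem_curve e he w hx₂ (by rwa [hp₂, ← hp₁])
    · rw [hcurve₂ e he, hpos₂ w hw] at hwe
      exact h₂.pos_mem_curve e he w hw hwe
  · rintro e (he | he) e' (he' | he') hee z hz hz'
    · rw [hcurve₁ e he] at hz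
      rw [hcurve₁ e' he'] at hz'
      obtain ⟨w, hw, hw', hwz⟩ := h₁.curve_inter e he e' he' hee z hz hz'
      refine ⟨w, hw, hw', ?_⟩
      rw [hpos₁ w ?_, hwz]
      obtain ⟨v, rfl⟩ := hw
      exact (h₁.adj w v he).1
    · rw [hcurve₁ e he] at hz
      rw [hcurve₂ e' he'] at hz'
      exact ⟨x, hinter e he e' he' z hz hz'⟩
    · rw [hcurve₂ e he] at hz
      rw [hcurve₁ e' he'] at hz'
      obtain ⟨h, h', h''⟩ := hinter e' he' e he z hz' hz
      exact ⟨x, h', h, h''⟩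
    · rw [hcurve₂ e he] at hz
      rw [hcurve₂ e' he'] at hz'
      obtain ⟨w, hw, hw', hwz⟩ := h₂.curve_inter e he e' he' hee z hz hz'
      refine ⟨w, hw, hw', ?_⟩
      rw [hpos₂ w ?_, hwz]
      obtain ⟨v, rfl⟩ := hw
      exact (h₂.adj w v he).1

/-- A drawing of a binary tree with distinct labels places the labels and draws the edges between
parents and children without crossings; the parts of the drawing are glued together at the
vertices. -/
theorem Branch.exists_isPlacement {S : Set (ℝ × ℝ)} {G : SimpleGraph α} {x : α} {t : BinaryTree α}
    {p : ℝ × ℝ} {K : Set (ℝ × ℝ)} (h : Branch S t p K) (hp : p ∈ S) (ht : HangsIn G x t)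
    (hx : x ∉ labels t) :
    ∃ pos curve, IsPlacement S (insert x (labels t)) (treeEdges x t) K pos curve ∧ pos x = p := by
  induction t generalizing x p K with
  | nil =>
    rw [show K = {p} from h, labels, treeEdges, insert_empty_eq]
    exact ⟨_, _, isPlacement_vertex hp, rfl⟩
  | node a l r ihl ihr =>
    obtain ⟨q, hq, Kl, Kr, e, hl, hr, hlr, he, hpq, heK, rfl⟩ := h
    obtain ⟨hxa, hal, har, hd, htl, htr⟩ := ht
    simp only [labels, Set.mem_insert_iff, Set.mem_union, not_or] at hx
    obtain ⟨pos₁, curve₁, h₁, hpos₁⟩ := ihl hl hq htl hal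
    obtain ⟨pos₂, curve₂, h₂, hpos₂⟩ := ihr hr hq htr har
    obtain ⟨pos₃, curve₃, h₃, hpos₃, -⟩ := h₁.glue h₂ (Set.mem_insert _ _) (Set.mem_insert _ _)
      hpos₁ hpos₂ (fun v hv hv' => by
        rcases hv with rfl | hv
        · rfl
        · rcases hv' with rfl | hv'
          · rfl
          · exact absurd hv' (Set.disjoint_left.1 hd hv)) hlr
    obtain ⟨pos₀, curve₀, h₀, hpos₀, hpos₀'⟩ := exists_isPlacement_edge hx.1 hp hq hpq he
    obtain ⟨pos, curve, h, hpos, -⟩ := h₀.glue h₃ (x := a) (p := q) (Or.inr rfl)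
      (Or.inl (Set.mem_insert _ _)) hpos₀' ((hpos₃ a (Set.mem_insert _ _)).trans hpos₁)
      (fun v hv hv' => by
        rcases hv with rfl | hv
        · rcases hv' with (h | h) | (h | h)
          exacts [h, absurd h hx.2.1, h, absurd h hx.2.2]
        · exact hv) heK
    refine ⟨pos, curve, ?_, (hpos x (Or.inl rfl)).trans hpos₀⟩
    have e1 : insert x (labels (.node a l r)) =
        ({x, a} ∪ (insert a (labels l) ∪ insert a (labels r)) : Set α) := by
      ext v
      simp only [labels, Set.mem_insert_iff, Set.mem_union, Set.mem_singleton_iff]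
      tauto
    have e2 : treeEdges x (.node a l r) = {s(x, a)} ∪ (treeEdges a l ∪ treeEdges a r) := rfl
    rw [e1, e2]
    exact h

theorem IsPlacement.hasPlanarLDrawing {G : SimpleGraph α} {P : Finset (ℝ × ℝ)}
    {K : Set (ℝ × ℝ)} {pos : α → ℝ × ℝ} {curve : Sym2 α → Set (ℝ × ℝ)}
    (h : IsPlacement P Set.univ G.edgeSet K pos curve) : HasPlanarLDrawing G P :=
  ⟨pos, curve, fun v => h.pos_mem v trivial, Set.injOn_univ.1 h.injOn, fun u v huv =>
    h.curve_eq u v huv, fun e he w hw => h.pos_mem_curve e he w trivial hw, h.curve_inter⟩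

end

theorem mainTheorem2 :
    ∃ c : ℝ, 0 < c ∧
      ∀ (V : Type*) [Fintype V] (G : SimpleGraph V) [DecidableRel G.Adj],
        G.IsTree → (∀ v, G.degree v ≤ 3) →
          ∀ P : Finset (ℝ × ℝ), GeneralOrthogonalPosition P →
            c * (Fintype.card V : ℝ) ^ (1.22 : ℝ) ≤ (P.card : ℝ) →
              HasPlanarLDrawing G P := by
  refine ⟨10 ^ 30, by positivity, fun V _ G _ hG hdeg P hP hc => ?_⟩
  obtain ⟨x, t, ht, hxt, huniv, hedges⟩ := exists_hangsIn hG hdeg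
  have hcard : (BinaryTree.node x t .nil).numNodes = Fintype.card V := by
    have h1 := congrArg Set.ncard huniv
    rw [Set.ncard_insert_of_notMem hxt, ht.ncard_labels, Set.ncard_univ,
      Nat.card_eq_fintype_card] at h1
    simpa [BinaryTree.numNodes] using h1
  obtain ⟨q, K, hK⟩ := drawingCost_pointCount.topDrawable (Fintype.card V + 1)
    (BinaryTree.node x t .nil) (by simp) (by rw [hcard]; exact Nat.lt_succ_self _) P hP
    (by rw [hcard]; exact Nat.ceil_le.2 hc)
  obtain ⟨hq, Kt, -, hb, -⟩ := hK.drawn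
  obtain ⟨pos, curve, h, -⟩ := hb.exists_isPlacement hq ht hxt
  rw [huniv, hedges] at h
  exact h.hasPlanarLDrawing
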